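/- Setting. Let $\mathbb S\subset\mathbb R^3$ be the unit sphere with surface measure $d\xi$ of mass $4\pi$, let $\mathbb H_\ell$ be the space of spherical harmonics of degree $\ell$, $\mathcal Y_{\ell,m}$ ($-\ell\le m\le \ell$) its usual orthonormal basis, and $L_\ell$ the Legendre polynomial of degree $\ell$ normalized by $L_\ell(1)=\frac{2\ell+1}{4\pi}$. Let $X$ be a (jointly measurable) real, centered, mean-square continuous, second-order stationary Gaussian random field on $\mathbb S$, with coefficients $a_{\ell,m}=\langle X,\mathcal Y_{\ell,m}\rangle_{L^2(\mathbb S)}$ and angular power spectrum $C_\ell=\mathbf E|a_{\ell,m}|^2$. Fix $\mathcal B>1$, an integer $M\ge 3$ and an $M$ times differentiable function $\mathbf a:\mathbb R\to\mathbb R$ supported in $[-\mathcal B,\mathcal B]$ and equal to $1$ on $[-\mathcal B^{-1},\mathcal B^{-1}]$; put $\mathbf b(x)=\mathbf a(x/\mathcal B)-\mathbf a(x)$ and $b_{j,\ell}=\mathbf b(\mathcal B^{-j}\ell)$. Assume that for some $\alpha>2$ one has $C_\ell=\ell^{-\alpha}\mathbf g_j(\mathcal B^{-j}\ell)$ for all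 $j\in\mathbb N$ and $\ell\in[\mathcal B^{j-1},\mathcal B^{j+1}]$, where the functions $\mathbf g_j$ are $M$ times differentiable on $[\mathcal B^{-1},\mathcal B]$ and, for positive constants $c_0,\dots,c_M$ independent of $j$, satisfy $c_0^{-1}\le \mathbf g_j\le c_0$ and $|\mathbf g_j^{(r)}|\le c_r$ for all $r\le M$. Put $C^{(j)}=\frac1{4\pi}\sum_{\ell\ge0}(2\ell+1)b_{j,\ell}^2C_\ell$. For every scale $j\in\mathbb N$ let $L_j\ge1$ be an integer, non-decreasing in $j$, such that $b_{j,\ell}=0$ for $\ell>L_j$ and $L_j\le\kappa\mathcal B^j$ with $\kappa$ independent of $j$. Let $(\xi_{j,k},\lambda_{j,k})_{1\le k\le N_j}$ be a pixelization of order $L=4L_j$: points of $\mathbb S$ and positive weights with $\int f\,d\xi=\sum_k\lambda_{j,k}f(\xi_{j,k})$ for all $f\in\bigoplus_{\ell\le L}\mathbb H_\ell$, such that $N_j/L^2$, $L^2\lambda_{j,k}$, $L\sup_\xi\min_kd(\xi,\xi_{j,k})$ and $L\min_{k\ne k'}d(\xi_{j,k},\xi_{j,k'})$ lie between two positive constants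 independent of $j$ and $k$, where $d$ is the geodesic distance. Let $W_{j,k}\in[0,1]$ (the mask), $\sigma_{j,k}\ge0$, and let $\mathbf B_{j,\ell}\in\mathbb R$ satisfy $\mathbf B_{j,\ell}=1$ for $\ell\le L_j$ and $\mathbf B_{j,\ell}=0$ for $\ell>2L_j$. One observes $$Y_{j,k}=W_{j,k}\big(X_j(\xi_{j,k})+\sigma_{j,k}U_{j,k}\big),\qquad X_j=\sum_{\ell\ge0}\sum_{m=-\ell}^{\ell}\mathbf B_{j,\ell}\,a_{\ell,m}\mathcal Y_{\ell,m},$$ with independent standard Gaussian $U_{j,k}$, independent of $X$. Put $\psi_{j,k}(\xi)=\sqrt{\lambda_{j,k}}\sum_\ell b_{j,\ell}L_\ell(\xi\cdot\xi_{j,k})$, $$\gamma_{j,k}=\lambda_{j,k}^{-1/2}\sum_p\lambda_{j,p}\psi_{j,k}(\xi_{j,p})Y_{j,p},\qquad n_{j,k}^2=\lambda_{j,k}^{-1}\sum_p\big(\lambda_{j,p}W_{j,p}\sigma_{j,p}\psi_{j,k}(\xi_{j,p})\big)^2 .$$ For thresholds $t_j\in\mathbb R$ let $\mathcal K_j=\{k:\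 (\sum_p\lambda_{j,p}(1-W_{j,p})^2\psi_{j,k}(\xi_{j,p})^2)^{1/2}\le t_j\}$, and for real weights with $\sum_kw_{j,k}=1$ let $\widehat C^{(j)}=\sum_kw_{j,k}(\gamma_{j,k}^2-n_{j,k}^2)$. **Proposition 7.** (i) Suppose that $\sup_{j,\ell}|\mathbf B_{j,\ell}|<\infty$. For every $A$ there is a constant $c>0$ such that, for all thresholds $(t_j)$, all weights and all $j$ with $\sum_kw_{j,k}=1$, $\sum_k|w_{j,k}|\le A$ (for nonnegative weights, $A=1$) and $w_{j,k}=0$ for $k\notin\mathcal K_j$, the estimator $\widehat C^{(j)}$ is integrable and $$|\mathbf E\widehat C^{(j)}-C^{(j)}|\le c\,\mathcal B^{\alpha j}\,t_j\,C^{(j)},$$ that is, $|\mathbf E\widehat C^{(j)}-C^{(j)}|/C^{(j)}\le c\,\mathcal B^{\alpha j}t_j$ whenever $C^{(j)}\ne0$. (ii) If $W_{j,k}=1$ for all $k$ (no mask), then for every choice of real weights with $\sum_kw_{j,k}=1$ the estimator $\widehat C^{(j)}$ is integrable and $\mathbf E\widehat C^{(j)}=C^{(j)}$. -/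

import Mathlib

open MeasureTheory ProbabilityTheory Filter Topology

noncomputable section

namespace Needlet

/-! ### The unit sphere of `ℝ³` -/

/-- The unit sphere in Euclidean three-space. -/
abbrev S2 : Type := Metric.sphere (0 : EuclideanSpace ℝ (Fin 3)) 1

/-- The rotation-invariant surface measure on the sphere, of total mass `4π`. -/
def sphereMeasure : Measure S2 :=
  (volume : Measure (EuclideanSpace ℝ (Fin 3))).toSphere

/-- The dot product of two points of the sphere, seen as vectors of `ℝ³`. -/
def dot (x y : S2) : ℝ := inner ℝ (x : EuclideanSpace ℝ (Fin 3)) (y : EuclideanSpace ℝ (Fin 3))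

/-- The geodesic distance. -/
def geoDist (x y : S2) : ℝ := Real.arccos (dot x y)

/-- The action of a linear isometry of `ℝ³` on the sphere. -/
def rotate (ρ : EuclideanSpace ℝ (Fin 3) ≃ₗᵢ[ℝ] EuclideanSpace ℝ (Fin 3)) (x : S2) : S2 :=
  ⟨ρ (x : EuclideanSpace ℝ (Fin 3)), by
    simp [ρ.norm_map (x : EuclideanSpace ℝ (Fin 3))]⟩

/-! ### Spherical harmonics -/

/-- The algebraic Laplacian on complex polynomials in three variables. -/
def polyLaplacian : MvPolynomial (Fin 3) ℂ →ₗ[ℂ] MvPolynomial (Fin 3) ℂ :=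
  ∑ i : Fin 3, (MvPolynomial.pderiv (R := ℂ) i).toLinearMap ∘ₗ
    (MvPolynomial.pderiv (R := ℂ) i).toLinearMap

/-- Restriction of a complex polynomial to the sphere. -/
def restrictToSphere : MvPolynomial (Fin 3) ℂ →ₗ[ℂ] (S2 → ℂ) where
  toFun p x := MvPolynomial.eval
    (fun i : Fin 3 => (((x : EuclideanSpace ℝ (Fin 3)) i : ℝ) : ℂ)) p
  map_add' p q := by
    funext x
    simp
  map_smul' r p := by
    funext x
    simp [MvPolynomial.smul_eval]

/-- `ℍ_ℓ`: restrictions to the sphere of harmonic homogeneous polynomials of degree `ℓ`. -/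
def harmonicSpace (ℓ : ℕ) : Submodule ℂ (S2 → ℂ) :=
  (MvPolynomial.homogeneousSubmodule (Fin 3) ℂ ℓ ⊓ LinearMap.ker polyLaplacian).map
    restrictToSphere

/-- The Legendre polynomial with the usual normalization `P_ℓ(1) = 1` (Rodrigues' formula). -/
def legendreP (ℓ : ℕ) : Polynomial ℝ :=
  Polynomial.C ((1 : ℝ) / (2 ^ ℓ * (ℓ.factorial : ℝ))) *
    (Polynomial.derivative^[ℓ] ((Polynomial.X ^ 2 - 1) ^ ℓ))

/-- The Legendre polynomial `L_ℓ`, normalized by `L_ℓ(1) = (2ℓ+1)/(4π)`, as a function. -/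
def legendreL (ℓ : ℕ) (u : ℝ) : ℝ :=
  (2 * (ℓ : ℝ) + 1) / (4 * Real.pi) * (legendreP ℓ).eval u

/-- The usual spherical harmonic `𝒴_{ℓ,m}`, `-ℓ ≤ m ≤ ℓ`, in Cartesian form. For `m ≥ 0`, with
`ξ = (sin θ cos φ, sin θ sin φ, cos θ)`, one has
`(ξ₀ + i ξ₁)^m P_ℓ^{(m)}(ξ₂) = e^{imφ} (sin θ)^m P_ℓ^{(m)}(cos θ)`. The phases are chosen so that
`𝒴_{ℓ,-m}` is the complex conjugate of `𝒴_{ℓ,m}`. -/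
def sphericalHarmonic (ℓ : ℕ) (m : ℤ) (x : S2) : ℂ :=
  ((Real.sqrt ((2 * (ℓ : ℝ) + 1) / (4 * Real.pi) *
      (((ℓ - m.natAbs).factorial : ℝ) / ((ℓ + m.natAbs).factorial : ℝ))) : ℝ) : ℂ) *
  ((((x : EuclideanSpace ℝ (Fin 3)) 0 : ℝ) : ℂ) +
      (if 0 ≤ m then Complex.I else -Complex.I) *
        (((x : EuclideanSpace ℝ (Fin 3)) 1 : ℝ) : ℂ)) ^ m.natAbs *
  (((Polynomial.derivative^[m.natAbs] (legendreP ℓ)).eval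
      ((x : EuclideanSpace ℝ (Fin 3)) 2) : ℝ) : ℂ)

/-! ### Random fields on the sphere -/

/-- A real-valued random field on the sphere (jointly measurable in the point and the outcome)
that is square integrable, centered, mean square continuous, second-order stationary and
Gaussian. -/
structure IsStationaryGaussianField {Ω : Type*} [MeasurableSpace Ω]
    (X : S2 → Ω → ℝ) (P : Measure Ω) : Prop where
  measurable : Measurable (fun z : S2 × Ω => X z.1 z.2)
  memLp : ∀ x, MemLp (X x) 2 P
  centered : ∀ x, ∫ ω, X x ω ∂P = 0
  meanSquareContinuous : ∀ x₀,
    Tendsto (fun x => ∫ ω, (X x ω - X x₀ ω) ^ 2 ∂P) (𝓝 x₀) (𝓝 0)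
  stationary : ∀ ρ : EuclideanSpace ℝ (Fin 3) ≃ₗᵢ[ℝ] EuclideanSpace ℝ (Fin 3),
    LinearMap.det (ρ.toLinearEquiv : EuclideanSpace ℝ (Fin 3) →ₗ[ℝ] EuclideanSpace ℝ (Fin 3)) = 1 →
    ∀ x y, ∫ ω, X (rotate ρ x) ω * X (rotate ρ y) ω ∂P = ∫ ω, X x ω * X y ω ∂P
  gaussian : IsGaussianProcess X P

/-- The random spherical harmonic coefficient `a_{ℓ,m} = ⟨X, 𝒴_{ℓ,m}⟩`. -/
def harmonicCoeff {Ω : Type*} (X : S2 → Ω → ℝ) (ℓ : ℕ) (m : ℤ) (ω : Ω) : ℂ :=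
  ∫ x, (X x ω : ℂ) * (starRingEnd ℂ) (sphericalHarmonic ℓ m x) ∂sphereMeasure

/-- The angular power spectrum `C_ℓ = E|a_{ℓ,m}|²`. For a stationary field this does not depend
on `m`; the definition takes the mean over the `2ℓ+1` values of `m`. -/
def powerSpectrum {Ω : Type*} [MeasurableSpace Ω] (X : S2 → Ω → ℝ) (P : Measure Ω) (ℓ : ℕ) : ℝ :=
  (1 / (2 * (ℓ : ℝ) + 1)) *
    ∑ m ∈ Finset.Icc (-(ℓ : ℤ)) (ℓ : ℤ), ∫ ω, ‖harmonicCoeff X ℓ m ω‖ ^ 2 ∂P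

/-! ### Pixelizations -/

/-- `(ξ_k, λ_k)_k` is a pixelization of order `L`, with constant `c₀`. -/
structure IsPixelization (c₀ : ℝ) (L N : ℕ) (ξ : Fin N → S2) (lam : Fin N → ℝ) : Prop where
  weight_pos : ∀ k, 0 < lam k
  /-- cubature formula on `⨁_{ℓ ≤ L} ℍ_ℓ` -/
  cubature : ∀ f ∈ ⨆ ℓ ∈ Set.Iic L, harmonicSpace ℓ,
    ∫ x, f x ∂sphereMeasure = ∑ k, (lam k : ℂ) * f (ξ k)
  card_lower : c₀⁻¹ * (L : ℝ) ^ 2 ≤ N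
  card_upper : (N : ℝ) ≤ c₀ * (L : ℝ) ^ 2
  weight_lower : ∀ k, c₀⁻¹ * ((L : ℝ) ^ 2)⁻¹ ≤ lam k
  weight_upper : ∀ k, lam k ≤ c₀ * ((L : ℝ) ^ 2)⁻¹
  /-- lower bound on the (attained) covering radius -/
  covering_lower : ∃ x, ∀ k, c₀⁻¹ * (L : ℝ)⁻¹ ≤ geoDist x (ξ k)
  covering_upper : ∀ x, ∃ k, geoDist x (ξ k) ≤ c₀ * (L : ℝ)⁻¹
  separation_lower : ∀ k k', k ≠ k' → c₀⁻¹ * (L : ℝ)⁻¹ ≤ geoDist (ξ k) (ξ k')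
  separation_upper : ∃ k k', k ≠ k' ∧ geoDist (ξ k) (ξ k') ≤ c₀ * (L : ℝ)⁻¹

/-! ### Window functions and the regularity of the spectrum -/

/-- The function `a` is `M` times differentiable, supported in `[-B, B]` and identically `1` on
`[-1/B, 1/B]`. -/
structure IsWindowProfile (B : ℝ) (M : ℕ) (a : ℝ → ℝ) : Prop where
  differentiable : ∀ r < M, Differentiable ℝ (iteratedDeriv r a)
  support : Function.support a ⊆ Set.Icc (-B) B
  eq_one : ∀ x ∈ Set.Icc (-B⁻¹) B⁻¹, a x = 1

/-- The `B`-adic window `b_{j,ℓ} = b(B^{-j} ℓ)`, where `b(x) = a(x / B) - a(x)`. -/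
def window (B : ℝ) (a : ℝ → ℝ) (j ℓ : ℕ) : ℝ :=
  a ((ℓ : ℝ) / B ^ j / B) - a ((ℓ : ℝ) / B ^ j)

/-- Regularity of a power spectrum: `C_ℓ = ℓ^{-α} g_j(B^{-j} ℓ)` for `B^{j-1} ≤ ℓ ≤ B^{j+1}`, where
the `g_j` are `M` times differentiable on `[1/B, B]`, bounded above and away from zero uniformly
in `j`, with derivatives up to order `M` bounded uniformly in `j`. -/
def IsRegularSpectrum (B : ℝ) (M : ℕ) (α : ℝ) (C : ℕ → ℝ) : Prop :=
  ∃ (g : ℕ → ℝ → ℝ) (c : ℕ → ℝ),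
    (∀ r ≤ M, 0 < c r) ∧
    (∀ j ℓ : ℕ, B ^ ((j : ℤ) - 1) ≤ (ℓ : ℝ) → (ℓ : ℝ) ≤ B ^ (j + 1) →
      C ℓ = (ℓ : ℝ) ^ (-α) * g j ((ℓ : ℝ) / B ^ j)) ∧
    (∀ j, ∀ u ∈ Set.Icc B⁻¹ B, (c 0)⁻¹ ≤ g j u ∧ g j u ≤ c 0) ∧
    (∀ j, ∀ r < M, DifferentiableOn ℝ (iteratedDerivWithin r (g j) (Set.Icc B⁻¹ B))
      (Set.Icc B⁻¹ B)) ∧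
    (∀ j, ∀ r ≤ M, ∀ u ∈ Set.Icc B⁻¹ B,
      |iteratedDerivWithin r (g j) (Set.Icc B⁻¹ B) u| ≤ c r)

/-- The smoothed spectrum `C^{(j)} = (4π)⁻¹ ∑_ℓ (2ℓ+1) b_{j,ℓ}² C_ℓ` (a finite sum). -/
def bandSpectrum (B : ℝ) (a : ℝ → ℝ) (C : ℕ → ℝ) (j : ℕ) : ℝ :=
  (4 * Real.pi)⁻¹ * ∑' ℓ : ℕ, (2 * (ℓ : ℝ) + 1) * window B a j ℓ ^ 2 * C ℓ

/-! ### The observation model -/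

/-- The deterministic data of the observation model, at all scales `j`: resolutions `L_j` covering
the window `b_j` and of order `B^j` (with constant `κ`), pixelizations of order `4 L_j`,
masks `W_j` with values in `[0,1]`, noise levels `σ_j ≥ 0`, and low-pass filters `𝐁_j`. -/
structure Design (B : ℝ) (a : ℝ → ℝ) (c₀ κ : ℝ) where
  L : ℕ → ℕ
  L_pos : ∀ j, 1 ≤ L j
  L_mono : Monotone L
  window_band : ∀ j ℓ, L j < ℓ → window B a j ℓ = 0
  L_le : ∀ j, (L j : ℝ) ≤ κ * B ^ j
  N : ℕ → ℕ
  ξ : ∀ j, Fin (N j) → S2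
  lam : ∀ j, Fin (N j) → ℝ
  pixelization : ∀ j, IsPixelization c₀ (4 * L j) (N j) (ξ j) (lam j)
  W : ∀ j, Fin (N j) → ℝ
  W_mem : ∀ j k, W j k ∈ Set.Icc (0 : ℝ) 1
  σ : ∀ j, Fin (N j) → ℝ
  σ_nonneg : ∀ j k, 0 ≤ σ j k
  beam : ℕ → ℕ → ℝ
  beam_low : ∀ j ℓ, ℓ ≤ L j → beam j ℓ = 1
  beam_high : ∀ j ℓ, 2 * L j < ℓ → beam j ℓ = 0

namespace Design

variable {B : ℝ} {a : ℝ → ℝ} {c₀ κ : ℝ} (D : Design B a c₀ κ)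

/-- The array `U` consists of independent standard Gaussian variables and is independent of the
process `X`. -/
structure IsNoise {Ω : Type*} [MeasurableSpace Ω] (X : S2 → Ω → ℝ)
    (U : (Σ j : ℕ, Fin (D.N j)) → Ω → ℝ) (P : Measure Ω) : Prop where
  measurable : ∀ i, Measurable (U i)
  law : ∀ i, P.map (U i) = gaussianReal 0 1
  indep : iIndepFun U P
  indep_field : IndepFun (fun ω x => X x ω) (fun ω i => U i ω) P

/-- The low-passed field `X_j = ∑_ℓ ∑_m 𝐁_{j,ℓ} a_{ℓ,m} 𝒴_{ℓ,m}` (a finite sum). The sum is real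
since `X` is real; the real part only records this. -/
def lowPass {Ω : Type*} (X : S2 → Ω → ℝ) (j : ℕ) (x : S2) (ω : Ω) : ℝ :=
  (∑' ℓ : ℕ, ∑ m ∈ Finset.Icc (-(ℓ : ℤ)) (ℓ : ℤ),
    (D.beam j ℓ : ℂ) * harmonicCoeff X ℓ m ω * sphericalHarmonic ℓ m x).re

/-- The observations `Y_{j,k} = W_{j,k} (X_j(ξ_{j,k}) + σ_{j,k} U_{j,k})`. -/
def obs {Ω : Type*} (X : S2 → Ω → ℝ) (U : (Σ j : ℕ, Fin (D.N j)) → Ω → ℝ)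
    (j : ℕ) (k : Fin (D.N j)) (ω : Ω) : ℝ :=
  D.W j k * (D.lowPass X j (D.ξ j k) ω + D.σ j k * U ⟨j, k⟩ ω)

/-- The needlet `ψ_{j,k}(ξ) = √λ_{j,k} ∑_ℓ b_{j,ℓ} L_ℓ(ξ · ξ_{j,k})` (a finite sum). -/
def needlet (j : ℕ) (k : Fin (D.N j)) (x : S2) : ℝ :=
  Real.sqrt (D.lam j k) * ∑' ℓ : ℕ, window B a j ℓ * legendreL ℓ (dot x (D.ξ j k))

/-- The needlet coefficients `λ_{j,k}^{-1/2} ∑_p λ_{j,p} ψ_{j,k}(ξ_{j,p}) f_p` of a finite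
sequence `f`. -/
def needletCoeff (j : ℕ) (f : Fin (D.N j) → ℝ) (k : Fin (D.N j)) : ℝ :=
  (Real.sqrt (D.lam j k))⁻¹ * ∑ p, D.lam j p * D.needlet j k (D.ξ j p) * f p

/-- The standard deviation `n_{j,k}` of the needlet coefficients of the masked noise. -/
def noiseLevel (j : ℕ) (k : Fin (D.N j)) : ℝ :=
  Real.sqrt ((D.lam j k)⁻¹ *
    ∑ p, (D.lam j p * (D.W j p * D.σ j p) * D.needlet j k (D.ξ j p)) ^ 2)

/-- The set `𝒦_j` of kept coefficients for the threshold `t`. -/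
def kept (j : ℕ) (t : ℝ) : Set (Fin (D.N j)) :=
  {k | Real.sqrt (∑ p, D.lam j p * (1 - D.W j p) ^ 2 * D.needlet j k (D.ξ j p) ^ 2) ≤ t}

/-- The needlet spectral estimator `Ĉ^{(j)} = ∑_k w_{j,k} (γ_{j,k}² - n_{j,k}²)`, where the
`γ_{j,k}` are the needlet coefficients of the observations. -/
def estimator {Ω : Type*} (X : S2 → Ω → ℝ) (U : (Σ j : ℕ, Fin (D.N j)) → Ω → ℝ)
    (j : ℕ) (w : Fin (D.N j) → ℝ) (ω : Ω) : ℝ :=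
  ∑ k, w k * (D.needletCoeff j (fun p => D.obs X U j p ω) k ^ 2 - D.noiseLevel j k ^ 2)

end Design

end Needlet

end

/-!
By the addition theorem, the field filtered by weights `c_ℓ` is the convolution of `X` with the
zonal kernel `∑ c_ℓ L_ℓ`, so that by stationarity its variance is `∑ (2 ℓ + 1) c_ℓ² C_ℓ / 4π` at
every point. Cubature is exact on products of the needlet with the low-passed field. Without mask
and noise, the coefficient `γ_{j,k}` is therefore the field filtered by `b_{j,ℓ}` at the point
`ξ_{j,k}`, and its variance is `C^{(j)}`. White noise adds exactly `n_{j,k}²` to the second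
moment, masked or not, and this proves unbiasedness in the absence of a mask.

In general the bias of a noiseless squared coefficient is `E[γ_W² - γ_1²]`, where `γ_v` is the
coefficient with mask `v`. Since `γ_1² - γ_W² = γ_{1-W} γ_{1+W}`, the Cauchy–Schwarz inequality on
the pixels bounds it by the mean pixel energy of `X_j` times the norms of the needlet weighted by
`1 - W` and by `1 + W`. The energy is bounded in `j` because `∑ (2 ℓ + 1) C_ℓ` converges for
`α > 2`. The first norm is at most `t_j / √λ_{j,k}` on `𝒦_j`, which is of order `B^j t_j`, and the
second one is at most `2 √S`, where `S` is the value of `C^{(j)}` for the flat spectrum. Finally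
`S` is either zero or at least of order `B^{2j}`, so that `B^j √S` is at most of order `S`, hence
of order `B^{α j} C^{(j)}`.
-/

noncomputable section

namespace Needlet

/-! ### Legendre polynomials -/

section Legendre

open Polynomial

lemma coeff_taylor_sq_sub_one_pow {r : ℝ} (hr : r ^ 2 = 1) (ℓ : ℕ) :
    (taylor r ((X ^ 2 - 1 : ℝ[X]) ^ ℓ)).coeff ℓ = (2 * r) ^ ℓ := by
  have hC : (C r : ℝ[X]) ^ 2 = 1 := by rw [← C_pow, hr, C_1]
  have hfactor : taylor r (X ^ 2 - 1 : ℝ[X]) = X * (X + C (2 * r)) := by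
    simp only [map_sub, taylor_pow, taylor_X, taylor_one, C_mul, map_ofNat, map_one]
    linear_combination hC
  rw [taylor_pow, hfactor, mul_pow, coeff_X_pow_mul', if_pos le_rfl, Nat.sub_self,
    coeff_zero_eq_eval_zero]
  simp

lemma legendreP_eval_of_sq_eq_one {r : ℝ} (hr : r ^ 2 = 1) (ℓ : ℕ) :
    (legendreP ℓ).eval r = r ^ ℓ := by
  have htaylor : (derivative^[ℓ] ((X ^ 2 - 1 : ℝ[X]) ^ ℓ)).eval r =
      (ℓ.factorial : ℝ) * (2 * r) ^ ℓ := by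
    rw [← coeff_taylor_sq_sub_one_pow hr, taylor_coeff, ← factorial_smul_hasseDeriv]
    simp
  rw [legendreP, eval_mul, eval_C, htaylor]
  field_simp
  rw [mul_pow]

lemma legendreP_eval_one (ℓ : ℕ) : (legendreP ℓ).eval 1 = 1 := by
  simp [legendreP_eval_of_sq_eq_one (one_pow 2) ℓ]

lemma legendreP_ne_zero (ℓ : ℕ) : legendreP ℓ ≠ 0 := fun h => by
  simpa [h] using legendreP_eval_one ℓ

lemma natDegree_legendreP (ℓ : ℕ) : (legendreP ℓ).natDegree = ℓ := by
  have hX : (X ^ 2 - 1 : ℝ[X]) = X ^ 2 - C 1 := by rw [C_1]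
  have hmonic : ((X ^ 2 - 1 : ℝ[X]) ^ ℓ).Monic := by
    rw [hX]; exact (monic_X_pow_sub_C 1 two_ne_zero).pow ℓ
  have hdeg : ((X ^ 2 - 1 : ℝ[X]) ^ ℓ).natDegree = ℓ + ℓ := by
    rw [hX, natDegree_pow, natDegree_X_pow_sub_C, mul_two]
  apply le_antisymm
  · refine (natDegree_C_mul_le _ _).trans ((natDegree_iterate_derivative _ _).trans ?_)
    lia
  · apply le_natDegree_of_ne_zero
    rw [legendreP, coeff_C_mul, coeff_iterate_derivative, ← hdeg, hmonic.coeff_natDegree]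
    refine mul_ne_zero (by positivity) ?_
    rw [nsmul_one, Nat.cast_ne_zero, Ne, Nat.descFactorial_eq_zero_iff_lt]
    lia

lemma iterate_derivative_legendreP (ℓ k : ℕ) :
    derivative^[k] (legendreP ℓ) = C ((1 : ℝ) / (2 ^ ℓ * (ℓ.factorial : ℝ))) *
      derivative^[k + ℓ] ((X ^ 2 - 1 : ℝ[X]) ^ ℓ) := by
  rw [legendreP, iterate_derivative_C_mul, Function.iterate_add_apply]

lemma derivative_sq_sub_one_pow_ode (ℓ : ℕ) :
    (1 - X ^ 2) * derivative ((X ^ 2 - 1 : ℝ[X]) ^ ℓ) =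
      -(2 * (ℓ : ℝ[X])) * X * (X ^ 2 - 1 : ℝ[X]) ^ ℓ := by
  rcases ℓ with _ | k
  · simp
  · simp only [derivative_pow, derivative_sub, derivative_X, derivative_one, Nat.add_sub_cancel,
      map_natCast]
    push_cast
    ring

lemma iterate_derivative_sq_sub_one_pow_ode (ℓ n : ℕ) :
    (1 - X ^ 2) * derivative^[n + 2] ((X ^ 2 - 1 : ℝ[X]) ^ ℓ) =
      2 * ((n : ℝ[X]) + 1 - (ℓ : ℝ[X])) * X * derivative^[n + 1] ((X ^ 2 - 1 : ℝ[X]) ^ ℓ) -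
        ((n : ℝ[X]) + 1) * (2 * (ℓ : ℝ[X]) - (n : ℝ[X])) *
          derivative^[n] ((X ^ 2 - 1 : ℝ[X]) ^ ℓ) := by
  induction n with
  | zero =>
    have h := congrArg derivative (derivative_sq_sub_one_pow_ode ℓ)
    simp only [derivative_mul, derivative_sub, derivative_neg, derivative_one, derivative_X_sq,
      derivative_X, derivative_natCast, derivative_ofNat, map_ofNat] at h
    simp only [Function.iterate_succ', Function.iterate_zero, Function.comp_apply, id]
    push_cast at h ⊢
    linear_combination h
  | succ n ih =>
    have h := congrArg derivative ih
    simp only [derivative_mul, derivative_sub, derivative_add, derivative_one, derivative_X_sq,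
      derivative_X, derivative_natCast, derivative_ofNat, map_ofNat,
      ← Function.iterate_succ_apply' derivative] at h
    push_cast at h ⊢
    linear_combination h

lemma iterate_derivative_legendreP_ode (ℓ m : ℕ) :
    (1 - X ^ 2) * derivative^[m + 2] (legendreP ℓ) =
      2 * ((m : ℝ[X]) + 1) * X * derivative^[m + 1] (legendreP ℓ) -
        (((ℓ * (ℓ + 1) : ℕ) : ℝ[X]) - ((m * (m + 1) : ℕ) : ℝ[X])) *
          derivative^[m] (legendreP ℓ) := by
  have h := iterate_derivative_sq_sub_one_pow_ode ℓ (m + ℓ)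
  simp only [iterate_derivative_legendreP, show m + 2 + ℓ = m + ℓ + 2 by ring,
    show m + 1 + ℓ = m + ℓ + 1 by ring]
  push_cast at h ⊢
  linear_combination C ((1 : ℝ) / (2 ^ ℓ * (ℓ.factorial : ℝ))) * h

lemma eval_iterate_derivative_legendreP_ode (ℓ m : ℕ) (u : ℝ) :
    (1 - u ^ 2) * (derivative^[m + 2] (legendreP ℓ)).eval u =
      2 * ((m : ℝ) + 1) * u * (derivative^[m + 1] (legendreP ℓ)).eval u -
        ((ℓ : ℝ) * (ℓ + 1) - m * (m + 1)) * (derivative^[m] (legendreP ℓ)).eval u := by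
  simpa using congrArg (eval u) (iterate_derivative_legendreP_ode ℓ m)

lemma degree_X_mul_derivative_legendreP_sub_lt (ℓ : ℕ) :
    (X * derivative (legendreP ℓ) - C (ℓ : ℝ) * legendreP ℓ).degree < (ℓ : WithBot ℕ) := by
  rw [degree_lt_iff_coeff_zero]
  intro n hn
  rcases n with _ | n
  · simp [Nat.le_zero.mp hn]
  · rw [coeff_sub, coeff_C_mul, coeff_X_mul, coeff_derivative]
    rcases hn.eq_or_lt with rfl | h
    · push_cast; ring
    · rw [coeff_eq_zero_of_natDegree_lt ((natDegree_legendreP ℓ).trans_lt h)]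
      simp

/-- A linear functional on polynomials proportional to integration over `[-1, 1]`. It is
characterized by an integration by parts without boundary terms, which is how invariance under
rotations is used for integrals over the sphere. -/
structure IsFlatFunctional (I : ℝ[X] →ₗ[ℝ] ℝ) : Prop where
  derivative_eq_zero : ∀ q : ℝ[X], I (derivative ((1 - X ^ 2) * q)) = 0

namespace IsFlatFunctional

variable {I : ℝ[X] →ₗ[ℝ] ℝ}

lemma legendreP_mul_eq_zero (hI : IsFlatFunctional I) {ℓ ℓ' : ℕ} (h : ℓ ≠ ℓ') :
    I (legendreP ℓ * legendreP ℓ') = 0 := by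
  have hwronskian : derivative ((1 - X ^ 2) * wronskian (legendreP ℓ) (legendreP ℓ')) =
      ((ℓ : ℝ) * (ℓ + 1) - ℓ' * (ℓ' + 1)) • (legendreP ℓ * legendreP ℓ') := by
    have h1 := iterate_derivative_legendreP_ode ℓ 0
    have h2 := iterate_derivative_legendreP_ode ℓ' 0
    simp only [Function.iterate_succ', Function.iterate_zero, Function.comp_apply, id] at h1 h2
    rw [smul_eq_C_mul]
    simp only [wronskian, derivative_mul, derivative_sub, derivative_one, derivative_X_pow]
    simp only [C_mul, C_add, C_sub, map_natCast, map_one] at h1 h2 ⊢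
    push_cast at h1 h2 ⊢
    linear_combination legendreP ℓ * h2 - legendreP ℓ' * h1
  have hzero := hI.derivative_eq_zero (wronskian (legendreP ℓ) (legendreP ℓ'))
  rw [hwronskian, map_smul, smul_eq_mul] at hzero
  refine (mul_eq_zero.mp hzero).resolve_left fun h0 => h ?_
  have hpos : (ℓ' : ℝ) + ℓ + 1 ≠ 0 := by positivity
  have hsub : ((ℓ : ℝ) - ℓ') * (ℓ' + ℓ + 1) = 0 := by linear_combination h0
  exact_mod_cast sub_eq_zero.mp ((mul_eq_zero.mp hsub).resolve_right hpos)

lemma legendreP_mul_eq_zero_of_degree_lt (hI : IsFlatFunctional I) {ℓ : ℕ} {q : ℝ[X]}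
    (hq : q.degree < ℓ) : I (legendreP ℓ * q) = 0 := by
  let S : Polynomial.Sequence ℝ :=
    { elems' := legendreP
      degree_eq' := fun i => by
        rw [degree_eq_natDegree (legendreP_ne_zero i), natDegree_legendreP] }
  have hspan := S.span_degreeLT (m := ℓ) fun i _ =>
    isUnit_iff_ne_zero.mpr (leadingCoeff_ne_zero.mpr (legendreP_ne_zero i))
  have hmem : q ∈ Submodule.span ℝ (S '' Set.Iio ℓ) := hspan ▸ mem_degreeLT.mpr hq
  clear hq
  induction hmem using Submodule.span_induction with
  | mem x hx =>
    obtain ⟨i, hi, rfl⟩ := hx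
    exact hI.legendreP_mul_eq_zero (ne_of_gt hi)
  | zero => simp
  | add x y _ _ hx hy => rw [mul_add, map_add, hx, hy, add_zero]
  | smul r x _ hx => rw [mul_smul_comm, map_smul, hx, smul_zero]

lemma derivative_eq (hI : IsFlatFunctional I) {f : ℝ[X]} (h1 : f.eval 1 = 1)
    (h2 : f.eval (-1) = -1) : I (derivative f) = I 1 := by
  obtain ⟨q, hq⟩ : (1 - X ^ 2 : ℝ[X]) ∣ f - X := by
    have ha : (X - C 1 : ℝ[X]) ∣ f - X := by rw [dvd_iff_isRoot]; simp [h1]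
    have hb : (X - C (-1) : ℝ[X]) ∣ f - X := by rw [dvd_iff_isRoot]; simp [h2]
    have hcop : IsCoprime (X - C 1 : ℝ[X]) (X - C (-1)) :=
      isCoprime_X_sub_C_of_isUnit_sub (by norm_num)
    have hfactor : (1 - X ^ 2 : ℝ[X]) = -((X - C 1) * (X - C (-1))) := by
      simp only [C_neg, C_1]; ring
    rw [hfactor, neg_dvd]
    exact hcop.mul_dvd ha hb
  have hzero := hI.derivative_eq_zero q
  rwa [← hq, derivative_sub, derivative_X, map_sub, sub_eq_zero] at hzero

lemma legendreP_mul_self (hI : IsFlatFunctional I) (ℓ : ℕ) :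
    (2 * (ℓ : ℝ) + 1) * I (legendreP ℓ * legendreP ℓ) = I 1 := by
  have heval : ((X : ℝ[X]) * (legendreP ℓ * legendreP ℓ)).eval (-1) = -1 := by
    simp [legendreP_eval_of_sq_eq_one (neg_one_sq (R := ℝ)) ℓ, ← mul_pow]
  have hderiv : derivative (X * (legendreP ℓ * legendreP ℓ)) =
      (2 * (ℓ : ℝ) + 1) • (legendreP ℓ * legendreP ℓ) +
        (2 : ℝ) • (legendreP ℓ * (X * derivative (legendreP ℓ) - C (ℓ : ℝ) * legendreP ℓ)) := by
    simp only [smul_eq_C_mul, derivative_mul, derivative_X, C_add, C_mul, map_natCast, map_ofNat,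
      map_one]
    ring
  have hlower :=
    hI.legendreP_mul_eq_zero_of_degree_lt (degree_X_mul_derivative_legendreP_sub_lt ℓ)
  have hflat := hI.derivative_eq (by simp [legendreP_eval_one]) heval
  rw [hderiv, map_add, map_smul, map_smul, hlower] at hflat
  simpa using hflat

end IsFlatFunctional

end Legendre

/-! ### Rotations -/

lemma sphere_ext {x y : S2} (h₀ : x.1 0 = y.1 0) (h₁ : x.1 1 = y.1 1) (h₂ : x.1 2 = y.1 2) :
    x = y := by
  apply Subtype.ext
  ext i
  fin_cases i
  exacts [h₀, h₁, h₂]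

lemma sphere_sq_sum (x : S2) : x.1 0 ^ 2 + x.1 1 ^ 2 + x.1 2 ^ 2 = 1 := by
  have h := x.2
  rw [mem_sphere_zero_iff_norm, EuclideanSpace.norm_eq, Real.sqrt_eq_one, Fin.sum_univ_three] at h
  simpa using h

lemma dot_eq (x y : S2) : dot x y = x.1 0 * y.1 0 + x.1 1 * y.1 1 + x.1 2 * y.1 2 := by
  simp [dot, PiLp.inner_apply, Fin.sum_univ_three, mul_comm]

lemma dot_comm (x y : S2) : dot x y = dot y x := real_inner_comm _ _

lemma dot_self (x : S2) : dot x x = 1 := by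
  rw [dot_eq]; linear_combination sphere_sq_sum x

lemma dot_rotate (ρ : EuclideanSpace ℝ (Fin 3) ≃ₗᵢ[ℝ] EuclideanSpace ℝ (Fin 3)) (x y : S2) :
    dot (rotate ρ x) (rotate ρ y) = dot x y :=
  ρ.inner_map_map _ _

/-- A rotation of `ℝ³`: a linear isometry of determinant one. -/
def IsRotation (ρ : EuclideanSpace ℝ (Fin 3) ≃ₗᵢ[ℝ] EuclideanSpace ℝ (Fin 3)) : Prop :=
  LinearMap.det (ρ.toLinearEquiv : EuclideanSpace ℝ (Fin 3) →ₗ[ℝ] EuclideanSpace ℝ (Fin 3)) = 1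

/-- The linear isometry of Euclidean space with a given orthogonal matrix. -/
def orthogonalIsometry {n : Type*} [Fintype n] [DecidableEq n] (A : Matrix.orthogonalGroup n ℝ) :
    EuclideanSpace ℝ n ≃ₗᵢ[ℝ] EuclideanSpace ℝ n :=
  Unitary.linearIsometryEquiv
    ⟨Matrix.toEuclideanCLM (n := n) (𝕜 := ℝ) A.1, Unitary.map_mem _ A.2⟩

lemma orthogonalIsometry_apply {n : Type*} [Fintype n] [DecidableEq n]
    (A : Matrix.orthogonalGroup n ℝ) (x : EuclideanSpace ℝ n) (i : n) :
    orthogonalIsometry A x i = ∑ k, A.1 i k * x k :=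
  rfl

lemma isRotation_orthogonalIsometry (A : Matrix.orthogonalGroup (Fin 3) ℝ) (hA : A.1.det = 1) :
    IsRotation (orthogonalIsometry A) := by
  have h : ((orthogonalIsometry A).toLinearEquiv :
      EuclideanSpace ℝ (Fin 3) →ₗ[ℝ] EuclideanSpace ℝ (Fin 3)) = Matrix.toEuclideanLin A.1 := rfl
  rw [IsRotation, h, Matrix.toEuclideanLin, Matrix.toLpLin_eq_toLin, LinearMap.det_toLin, hA]

/-- The rotation by the angle `θ` in the plane of the first two coordinates. -/
def rotXY (θ : ℝ) : EuclideanSpace ℝ (Fin 3) ≃ₗᵢ[ℝ] EuclideanSpace ℝ (Fin 3) :=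
  orthogonalIsometry
    ⟨!![Real.cos θ, -Real.sin θ, 0; Real.sin θ, Real.cos θ, 0; 0, 0, 1], by
      rw [Matrix.mem_orthogonalGroup_iff]
      ext i j
      fin_cases i <;> fin_cases j <;> simp [Matrix.mul_apply, Fin.sum_univ_three, ← sq, mul_comm]⟩

/-- The rotation by the angle `θ` in the plane of the first and the last coordinates. -/
def rotXZ (θ : ℝ) : EuclideanSpace ℝ (Fin 3) ≃ₗᵢ[ℝ] EuclideanSpace ℝ (Fin 3) :=
  orthogonalIsometry
    ⟨!![Real.cos θ, 0, -Real.sin θ; 0, 1, 0; Real.sin θ, 0, Real.cos θ], by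
      rw [Matrix.mem_orthogonalGroup_iff]
      ext i j
      fin_cases i <;> fin_cases j <;> simp [Matrix.mul_apply, Fin.sum_univ_three, ← sq, mul_comm]⟩

lemma isRotation_rotXY (θ : ℝ) : IsRotation (rotXY θ) :=
  isRotation_orthogonalIsometry _ (by simp [Matrix.det_fin_three, ← sq])

lemma isRotation_rotXZ (θ : ℝ) : IsRotation (rotXZ θ) :=
  isRotation_orthogonalIsometry _ (by simp [Matrix.det_fin_three, ← sq])

lemma rotate_rotXY_zero (θ : ℝ) (x : S2) :
    (rotate (rotXY θ) x).1 0 = x.1 0 * Real.cos θ - x.1 1 * Real.sin θ := by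
  simp [rotate, rotXY, orthogonalIsometry_apply, Fin.sum_univ_three]; ring

lemma rotate_rotXY_one (θ : ℝ) (x : S2) :
    (rotate (rotXY θ) x).1 1 = x.1 0 * Real.sin θ + x.1 1 * Real.cos θ := by
  simp [rotate, rotXY, orthogonalIsometry_apply, Fin.sum_univ_three]; ring

lemma rotate_rotXY_two (θ : ℝ) (x : S2) : (rotate (rotXY θ) x).1 2 = x.1 2 := by
  simp [rotate, rotXY, orthogonalIsometry_apply, Fin.sum_univ_three]

lemma rotate_rotXZ_zero (θ : ℝ) (x : S2) :
    (rotate (rotXZ θ) x).1 0 = x.1 0 * Real.cos θ - x.1 2 * Real.sin θ := by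
  simp [rotate, rotXZ, orthogonalIsometry_apply, Fin.sum_univ_three]; ring

lemma rotate_rotXZ_one (θ : ℝ) (x : S2) : (rotate (rotXZ θ) x).1 1 = x.1 1 := by
  simp [rotate, rotXZ, orthogonalIsometry_apply, Fin.sum_univ_three]

lemma rotate_rotXZ_two (θ : ℝ) (x : S2) :
    (rotate (rotXZ θ) x).1 2 = x.1 0 * Real.sin θ + x.1 2 * Real.cos θ := by
  simp [rotate, rotXZ, orthogonalIsometry_apply, Fin.sum_univ_three]; ring

lemma hasDerivAt_rotate_rotXZ_zero (x : S2) (t : ℝ) :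
    HasDerivAt (fun s => (rotate (rotXZ s) x).1 0) (-(rotate (rotXZ t) x).1 2) t := by
  simp only [rotate_rotXZ_zero, rotate_rotXZ_two]
  exact (((Real.hasDerivAt_cos t).const_mul (x.1 0)).fun_sub
    ((Real.hasDerivAt_sin t).const_mul (x.1 2))).congr_deriv (by ring)

lemma hasDerivAt_rotate_rotXZ_two (x : S2) (t : ℝ) :
    HasDerivAt (fun s => (rotate (rotXZ s) x).1 2) ((rotate (rotXZ t) x).1 0) t := by
  simp only [rotate_rotXZ_zero, rotate_rotXZ_two]
  exact (((Real.hasDerivAt_sin t).const_mul (x.1 0)).fun_add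
    ((Real.hasDerivAt_cos t).const_mul (x.1 2))).congr_deriv (by ring)

lemma rotate_rotXZ_angle_zero (x : S2) : rotate (rotXZ 0) x = x :=
  sphere_ext (by simp [rotate_rotXZ_zero]) (by simp [rotate_rotXZ_one])
    (by simp [rotate_rotXZ_two])

/-- The point `(0, 0, 1)` of the sphere. -/
def northPole : S2 := ⟨EuclideanSpace.single 2 1, by simp⟩

lemma northPole_zero : northPole.1 0 = 0 := by simp [northPole]

lemma northPole_one : northPole.1 1 = 0 := by simp [northPole]

lemma northPole_two : northPole.1 2 = 1 := by simp [northPole]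

lemma dot_northPole (x : S2) : dot x northPole = x.1 2 := by
  simp [dot_eq, northPole_zero, northPole_one, northPole_two]

lemma exists_angle (u v : ℝ) : ∃ θ : ℝ, u * Real.sin θ + v * Real.cos θ = 0 ∧
    u * Real.cos θ - v * Real.sin θ = √(u ^ 2 + v ^ 2) := by
  let z : ℂ := ⟨u, v⟩
  have hcos : ‖z‖ * Real.cos z.arg = u := Complex.norm_mul_cos_arg z
  have hsin : ‖z‖ * Real.sin z.arg = v := Complex.norm_mul_sin_arg z
  have hnorm : ‖z‖ = √(u ^ 2 + v ^ 2) := Complex.norm_eq_sqrt_sq_add_sq z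
  refine ⟨-z.arg, ?_, ?_⟩
  · rw [Real.sin_neg, Real.cos_neg, ← hcos, ← hsin]; ring
  · rw [Real.sin_neg, Real.cos_neg, ← hnorm, ← hcos, ← hsin]
    linear_combination ‖z‖ * Real.sin_sq_add_cos_sq z.arg

lemma exists_rotXZ_rotXY_eq_northPole (y : S2) :
    ∃ θ φ : ℝ, rotate (rotXZ φ) (rotate (rotXY θ) y) = northPole := by
  obtain ⟨θ, hθ, -⟩ := exists_angle (y.1 0) (y.1 1)
  set y' := rotate (rotXY θ) y with hy'
  have hy'_one : y'.1 1 = 0 := by rw [hy', rotate_rotXY_one, hθ]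
  obtain ⟨φ, hφ_zero, hφ_two⟩ := exists_angle (y'.1 2) (-y'.1 0)
  have hnorm : y'.1 2 ^ 2 + (-y'.1 0) ^ 2 = 1 := by
    linear_combination sphere_sq_sum y' - y'.1 1 * hy'_one
  rw [hnorm, Real.sqrt_one] at hφ_two
  refine ⟨θ, φ, sphere_ext ?_ ?_ ?_⟩
  · rw [rotate_rotXZ_zero, northPole_zero]; linear_combination -hφ_zero
  · rw [rotate_rotXZ_one, northPole_one, hy'_one]
  · rw [rotate_rotXZ_two, northPole_two]; linear_combination hφ_two

lemma eq_northPole_of_rotate_eq {β : Type*} (f : S2 → β)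
    (hf : ∀ ρ, IsRotation ρ → ∀ x, f (rotate ρ x) = f x) (x : S2) : f x = f northPole := by
  obtain ⟨θ, φ, h⟩ := exists_rotXZ_rotXY_eq_northPole x
  rw [← h, hf _ (isRotation_rotXZ φ), hf _ (isRotation_rotXY θ)]

/-! ### The addition theorem -/

/-- The spherical harmonic of degree `ℓ` and order `m ≥ 0`, up to its normalizing constant. -/
def rawHarmonic (ℓ m : ℕ) (x : S2) : ℂ :=
  ((x.1 0 : ℂ) + Complex.I * (x.1 1 : ℂ)) ^ m *
    (((Polynomial.derivative^[m] (legendreP ℓ)).eval (x.1 2) : ℝ) : ℂ)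

lemma rawHarmonic_eq_zero {ℓ m : ℕ} (h : ℓ < m) (x : S2) : rawHarmonic ℓ m x = 0 := by
  rw [rawHarmonic, Polynomial.iterate_derivative_eq_zero (by rwa [natDegree_legendreP])]
  simp

lemma im_rawHarmonic_zero (ℓ : ℕ) (x : S2) : (rawHarmonic ℓ 0 x).im = 0 := by
  simp [rawHarmonic]

/-- The derivative of `rawHarmonic` along the rotations `rotXZ`. -/
def rawHarmonicDeriv (ℓ m : ℕ) (x : S2) : ℂ :=
  -((m : ℂ) * (x.1 2 : ℂ) * ((x.1 0 : ℂ) + Complex.I * (x.1 1 : ℂ)) ^ (m - 1) *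
    (((Polynomial.derivative^[m] (legendreP ℓ)).eval (x.1 2) : ℝ) : ℂ)) +
  (x.1 0 : ℂ) * ((x.1 0 : ℂ) + Complex.I * (x.1 1 : ℂ)) ^ m *
    (((Polynomial.derivative^[m + 1] (legendreP ℓ)).eval (x.1 2) : ℝ) : ℂ)

lemma hasDerivAt_rawHarmonic (ℓ m : ℕ) (x : S2) (t : ℝ) :
    HasDerivAt (fun s => rawHarmonic ℓ m (rotate (rotXZ s) x))
      (rawHarmonicDeriv ℓ m (rotate (rotXZ t) x)) t := by
  have hpoly := ((Polynomial.derivative^[m] (legendreP ℓ)).hasDerivAt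
    ((rotate (rotXZ t) x).1 2)).comp t (hasDerivAt_rotate_rotXZ_two x t)
  have hpow := ((hasDerivAt_rotate_rotXZ_zero x t).ofReal_comp.add_const
    (Complex.I * (x.1 1 : ℂ))).pow m
  simp only [rawHarmonic, rawHarmonicDeriv, rotate_rotXZ_one]
  refine (hpow.mul hpoly.ofReal_comp).congr_deriv ?_
  simp only [Function.comp_apply, Function.iterate_succ', Pi.pow_apply]
  push_cast
  ring

lemma rawHarmonicDeriv_zero (ℓ : ℕ) (x : S2) :
    rawHarmonicDeriv ℓ 0 x = ((rawHarmonic ℓ 1 x).re : ℂ) := by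
  simp [rawHarmonicDeriv, rawHarmonic]

lemma rawHarmonicDeriv_succ (ℓ m : ℕ) (x : S2) :
    rawHarmonicDeriv ℓ (m + 1) x = (1 / 2) * rawHarmonic ℓ (m + 2) x -
      (1 / 2) * (((ℓ : ℂ) - m) * (ℓ + m + 1)) * rawHarmonic ℓ m x := by
  have hode := congrArg (fun r : ℝ => (r : ℂ)) (eval_iterate_derivative_legendreP_ode ℓ m (x.1 2))
  have hsphere := congrArg (fun r : ℝ => (r : ℂ)) (sphere_sq_sum x)
  simp only [rawHarmonicDeriv, rawHarmonic, Nat.add_sub_cancel, add_assoc, Nat.reduceAdd]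
  push_cast at hode hsphere ⊢
  set w := (x.1 0 : ℂ) + Complex.I * (x.1 1 : ℂ) with hw
  have hre : (x.1 0 : ℂ) * w = (1 / 2) * w ^ 2 + (1 / 2) * (1 - (x.1 2 : ℂ) ^ 2) := by
    rw [hw]
    linear_combination (1 / 2) * hsphere - (1 / 2) * (x.1 1 : ℂ) ^ 2 * Complex.I_sq
  linear_combination (1 / 2) * w ^ m * hode + w ^ m *
    (((Polynomial.derivative^[m + 2] (legendreP ℓ)).eval (x.1 2) : ℝ) : ℂ) * hre

/-- The ratio of factorials in the normalization of spherical harmonics. -/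
def harmonicWeight (ℓ m : ℕ) : ℝ := ((ℓ - m).factorial : ℝ) / ((ℓ + m).factorial : ℝ)

lemma harmonicWeight_nonneg (ℓ m : ℕ) : 0 ≤ harmonicWeight ℓ m := by
  unfold harmonicWeight; positivity

lemma harmonicWeight_zero (ℓ : ℕ) : harmonicWeight ℓ 0 = 1 :=
  div_self (by positivity)

lemma harmonicWeight_succ {ℓ m : ℕ} (h : m < ℓ) :
    harmonicWeight ℓ (m + 1) * (((ℓ : ℝ) - m) * (ℓ + m + 1)) = harmonicWeight ℓ m := by
  have hnum : (ℓ - m).factorial = (ℓ - m) * (ℓ - (m + 1)).factorial := by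
    rw [Nat.sub_add_eq, Nat.mul_factorial_pred (by lia)]
  have hden : (ℓ + (m + 1)).factorial = (ℓ + m + 1) * (ℓ + m).factorial := Nat.factorial_succ _
  rw [harmonicWeight, harmonicWeight, hnum, hden]
  push_cast [Nat.cast_sub h.le]
  field_simp

/-- The contribution of the order `m` to the addition theorem, before normalization. -/
def harmonicProduct (ℓ m : ℕ) (x y : S2) : ℝ :=
  (rawHarmonic ℓ m x * (starRingEnd ℂ) (rawHarmonic ℓ m y)).re

/-- The derivative of `harmonicProduct` along simultaneous rotations `rotXZ` is the real part of
this expression. -/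
def harmonicProductDeriv (ℓ m : ℕ) (x y : S2) : ℂ :=
  rawHarmonicDeriv ℓ m x * (starRingEnd ℂ) (rawHarmonic ℓ m y) +
    rawHarmonic ℓ m x * (starRingEnd ℂ) (rawHarmonicDeriv ℓ m y)

/-- The products of harmonics of consecutive orders: those left over when the derivatives
`harmonicProductDeriv` are summed by telescoping. -/
def harmonicCross (ℓ m : ℕ) (x y : S2) : ℂ :=
  rawHarmonic ℓ (m + 1) x * (starRingEnd ℂ) (rawHarmonic ℓ m y) +
    rawHarmonic ℓ m x * (starRingEnd ℂ) (rawHarmonic ℓ (m + 1) y)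

lemma hasDerivAt_harmonicProduct (ℓ m : ℕ) (x y : S2) (t : ℝ) :
    HasDerivAt (fun s => harmonicProduct ℓ m (rotate (rotXZ s) x) (rotate (rotXZ s) y))
      (harmonicProductDeriv ℓ m (rotate (rotXZ t) x) (rotate (rotXZ t) y)).re t :=
  Complex.reCLM.hasFDerivAt.comp_hasDerivAt t ((hasDerivAt_rawHarmonic ℓ m x t).mul
    (Complex.conjCLE.toContinuousLinearMap.hasFDerivAt.comp_hasDerivAt t
      (hasDerivAt_rawHarmonic ℓ m y t)))

lemma re_harmonicProductDeriv_zero (ℓ : ℕ) (x y : S2) :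
    (harmonicProductDeriv ℓ 0 x y).re = harmonicWeight ℓ 0 * (harmonicCross ℓ 0 x y).re := by
  simp [harmonicProductDeriv, harmonicCross, rawHarmonicDeriv_zero, harmonicWeight_zero,
    im_rawHarmonic_zero]

lemma re_harmonicProductDeriv_succ {ℓ m : ℕ} (h : m < ℓ) (x y : S2) :
    2 * harmonicWeight ℓ (m + 1) * (harmonicProductDeriv ℓ (m + 1) x y).re =
      harmonicWeight ℓ (m + 1) * (harmonicCross ℓ (m + 1) x y).re -
        harmonicWeight ℓ m * (harmonicCross ℓ m x y).re := by
  have hderiv : harmonicProductDeriv ℓ (m + 1) x y = (1 / 2 : ℝ) * harmonicCross ℓ (m + 1) x y -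
      ((1 / 2 * ((ℓ - m) * (ℓ + m + 1)) : ℝ) : ℂ) * harmonicCross ℓ m x y := by
    simp only [harmonicProductDeriv, harmonicCross, rawHarmonicDeriv_succ, map_sub, map_mul,
      map_add, map_div₀, map_one, map_ofNat, Complex.conj_natCast]
    push_cast
    ring
  rw [hderiv, Complex.sub_re, Complex.re_ofReal_mul, Complex.re_ofReal_mul]
  linear_combination -(harmonicCross ℓ m x y).re * harmonicWeight_succ h

/-- The sum over all orders in the addition theorem; the orders `m` and `-m` are taken together. -/
def harmonicKernel (ℓ : ℕ) (x y : S2) : ℝ :=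
  harmonicProduct ℓ 0 x y +
    ∑ m ∈ Finset.range ℓ, 2 * harmonicWeight ℓ (m + 1) * harmonicProduct ℓ (m + 1) x y

lemma hasDerivAt_harmonicKernel (ℓ : ℕ) (x y : S2) (t : ℝ) :
    HasDerivAt (fun s => harmonicKernel ℓ (rotate (rotXZ s) x) (rotate (rotXZ s) y)) 0 t := by
  refine ((hasDerivAt_harmonicProduct ℓ 0 x y t).fun_add
    (HasDerivAt.fun_sum (u := Finset.range ℓ) fun m _ =>
      (hasDerivAt_harmonicProduct ℓ (m + 1) x y t).const_mul
        (2 * harmonicWeight ℓ (m + 1)))).congr_deriv ?_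
  rw [Finset.sum_congr rfl fun m hm => re_harmonicProductDeriv_succ (Finset.mem_range.mp hm) _ _,
    Finset.sum_range_sub fun m => harmonicWeight ℓ m * (harmonicCross ℓ m _ _).re,
    re_harmonicProductDeriv_zero, add_sub_cancel]
  simp [harmonicCross, rawHarmonic_eq_zero (Nat.lt_succ_self ℓ)]

lemma harmonicKernel_rotXZ (ℓ : ℕ) (x y : S2) (θ : ℝ) :
    harmonicKernel ℓ (rotate (rotXZ θ) x) (rotate (rotXZ θ) y) = harmonicKernel ℓ x y := by
  have hconst := is_const_of_deriv_eq_zero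
    (fun t => (hasDerivAt_harmonicKernel ℓ x y t).differentiableAt)
    (fun t => (hasDerivAt_harmonicKernel ℓ x y t).deriv) θ 0
  simpa only [rotate_rotXZ_angle_zero] using hconst

lemma rawHarmonic_rotXY (ℓ m : ℕ) (x : S2) (θ : ℝ) :
    rawHarmonic ℓ m (rotate (rotXY θ) x) = Complex.exp (θ * Complex.I) ^ m * rawHarmonic ℓ m x := by
  rw [rawHarmonic, rawHarmonic, ← mul_assoc, ← mul_pow, rotate_rotXY_zero, rotate_rotXY_one,
    rotate_rotXY_two, Complex.exp_mul_I]
  congr 2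
  push_cast
  linear_combination -(x.1 1 : ℂ) * Complex.sin θ * Complex.I_sq

lemma harmonicProduct_rotXY (ℓ m : ℕ) (x y : S2) (θ : ℝ) :
    harmonicProduct ℓ m (rotate (rotXY θ) x) (rotate (rotXY θ) y) = harmonicProduct ℓ m x y := by
  have hunit : Complex.exp (θ * Complex.I) * (starRingEnd ℂ) (Complex.exp (θ * Complex.I)) = 1 := by
    rw [Complex.mul_conj, Complex.normSq_eq_norm_sq, Complex.norm_exp_ofReal_mul_I]
    simp
  rw [harmonicProduct, rawHarmonic_rotXY, rawHarmonic_rotXY, map_mul, map_pow, mul_mul_mul_comm,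
    ← mul_pow, hunit, one_pow, one_mul, harmonicProduct]

lemma harmonicKernel_rotXY (ℓ : ℕ) (x y : S2) (θ : ℝ) :
    harmonicKernel ℓ (rotate (rotXY θ) x) (rotate (rotXY θ) y) = harmonicKernel ℓ x y := by
  simp only [harmonicKernel, harmonicProduct_rotXY]

lemma harmonicKernel_northPole (ℓ : ℕ) (x : S2) :
    harmonicKernel ℓ x northPole = (legendreP ℓ).eval (x.1 2) := by
  simp [harmonicKernel, harmonicProduct, rawHarmonic, northPole_zero, northPole_one,
    northPole_two, legendreP_eval_one]

lemma harmonicKernel_eq (ℓ : ℕ) (x y : S2) :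
    harmonicKernel ℓ x y = (legendreP ℓ).eval (dot x y) := by
  obtain ⟨θ, φ, h⟩ := exists_rotXZ_rotXY_eq_northPole y
  rw [← harmonicKernel_rotXY ℓ x y θ, ← dot_rotate (rotXY θ), ← harmonicKernel_rotXZ ℓ _ _ φ,
    ← dot_rotate (rotXZ φ), h, dot_northPole, harmonicKernel_northPole]

lemma sphericalHarmonic_natCast (ℓ m : ℕ) (x : S2) : sphericalHarmonic ℓ m x =
    (√((2 * (ℓ : ℝ) + 1) / (4 * Real.pi) * harmonicWeight ℓ m) : ℂ) * rawHarmonic ℓ m x := by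
  simp [sphericalHarmonic, rawHarmonic, harmonicWeight, mul_assoc]

lemma sphericalHarmonic_neg_natCast (ℓ m : ℕ) (x : S2) : sphericalHarmonic ℓ (-(m : ℤ)) x =
    (starRingEnd ℂ) (sphericalHarmonic ℓ m x) := by
  rcases m with _ | m
  · simp [sphericalHarmonic]
  · have hneg : ¬ (0 ≤ -((m + 1 : ℕ) : ℤ)) := by lia
    simp only [sphericalHarmonic, Int.natAbs_neg, Int.natAbs_natCast, if_neg hneg,
      if_pos (Int.natCast_nonneg _), map_mul, map_pow, map_add, Complex.conj_ofReal,
      Complex.conj_I]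

lemma sum_Icc_neg_natCast {β : Type*} [AddCommGroup β] (F : ℤ → β) (n : ℕ) :
    ∑ m ∈ Finset.Icc (-(n : ℤ)) n, F m =
      F 0 + ∑ m ∈ Finset.range n, (F ((m + 1 : ℕ) : ℤ) + F (-((m + 1 : ℕ) : ℤ))) := by
  induction n with
  | zero => simp
  | succ n ih =>
    push_cast at ih ⊢
    rw [Finset.sum_Icc_succ_eq_add_endpoints, ih, Finset.sum_range_succ]
    abel

lemma sphericalHarmonic_mul_conj (ℓ m : ℕ) (x y : S2) :
    sphericalHarmonic ℓ m x * (starRingEnd ℂ) (sphericalHarmonic ℓ m y) =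
      (((2 * (ℓ : ℝ) + 1) / (4 * Real.pi) * harmonicWeight ℓ m : ℝ) : ℂ) *
        (rawHarmonic ℓ m x * (starRingEnd ℂ) (rawHarmonic ℓ m y)) := by
  have hsqrt := Real.mul_self_sqrt
    (mul_nonneg (by positivity : 0 ≤ (2 * (ℓ : ℝ) + 1) / (4 * Real.pi))
      (harmonicWeight_nonneg ℓ m))
  rw [sphericalHarmonic_natCast, sphericalHarmonic_natCast, map_mul, Complex.conj_ofReal,
    mul_mul_mul_comm, ← Complex.ofReal_mul, hsqrt]

lemma sphericalHarmonic_zero_mul_conj (ℓ : ℕ) (x y : S2) :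
    sphericalHarmonic ℓ 0 x * (starRingEnd ℂ) (sphericalHarmonic ℓ 0 y) =
      (((2 * (ℓ : ℝ) + 1) / (4 * Real.pi) * harmonicProduct ℓ 0 x y : ℝ) : ℂ) := by
  have hreal : rawHarmonic ℓ 0 x * (starRingEnd ℂ) (rawHarmonic ℓ 0 y) =
      (harmonicProduct ℓ 0 x y : ℂ) :=
    Complex.ext rfl (by simp [im_rawHarmonic_zero])
  have h := sphericalHarmonic_mul_conj ℓ 0 x y
  rwa [harmonicWeight_zero, mul_one, hreal, ← Complex.ofReal_mul] at h

lemma sphericalHarmonic_mul_conj_add_neg (ℓ m : ℕ) (x y : S2) :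
    sphericalHarmonic ℓ m x * (starRingEnd ℂ) (sphericalHarmonic ℓ m y) +
      sphericalHarmonic ℓ (-(m : ℤ)) x * (starRingEnd ℂ) (sphericalHarmonic ℓ (-(m : ℤ)) y) =
      (((2 * (ℓ : ℝ) + 1) / (4 * Real.pi) *
        (2 * harmonicWeight ℓ m * harmonicProduct ℓ m x y) : ℝ) : ℂ) := by
  rw [sphericalHarmonic_neg_natCast, sphericalHarmonic_neg_natCast, ← map_mul, Complex.add_conj,
    sphericalHarmonic_mul_conj, Complex.re_ofReal_mul, harmonicProduct]
  congr 1
  ring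

theorem sum_sphericalHarmonic_mul_conj (ℓ : ℕ) (x y : S2) :
    ∑ m ∈ Finset.Icc (-(ℓ : ℤ)) ℓ,
      sphericalHarmonic ℓ m x * (starRingEnd ℂ) (sphericalHarmonic ℓ m y) =
      (legendreL ℓ (dot x y) : ℂ) := by
  simp only [sum_Icc_neg_natCast, sphericalHarmonic_zero_mul_conj,
    sphericalHarmonic_mul_conj_add_neg, legendreL, ← harmonicKernel_eq, harmonicKernel]
  rw [← Complex.ofReal_sum, ← Complex.ofReal_add, ← Finset.mul_sum, mul_add]

/-! ### The surface measure -/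

instance : IsFiniteMeasure sphereMeasure := by unfold sphereMeasure; infer_instance

lemma sphereMeasure_real_univ : sphereMeasure.real Set.univ = 4 * Real.pi := by
  rw [sphereMeasure, Measure.toSphere_real_apply_univ, measureReal_def,
    EuclideanSpace.volume_ball_fin_three, ENNReal.ofReal_one, one_pow, one_mul,
    ENNReal.toReal_ofReal (by positivity), finrank_euclideanSpace, Fintype.card_fin]
  push_cast
  ring

lemma integrable_sphereMeasure_of_continuous {E : Type*} [NormedAddCommGroup E] {f : S2 → E}
    (hf : Continuous f) : Integrable f sphereMeasure :=
  hf.integrable_of_hasCompactSupport (HasCompactSupport.of_compactSpace f)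

lemma continuous_rotate (ρ : EuclideanSpace ℝ (Fin 3) ≃ₗᵢ[ℝ] EuclideanSpace ℝ (Fin 3)) :
    Continuous (rotate ρ) :=
  (ρ.continuous.comp continuous_subtype_val).subtype_mk _

/-- The action of a linear isometry of `ℝ³` on the sphere, as a homeomorphism. -/
def rotateHomeomorph (ρ : EuclideanSpace ℝ (Fin 3) ≃ₗᵢ[ℝ] EuclideanSpace ℝ (Fin 3)) :
    S2 ≃ₜ S2 where
  toFun := rotate ρ
  invFun := rotate ρ.symm
  left_inv x := Subtype.ext (ρ.symm_apply_apply x)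
  right_inv x := Subtype.ext (ρ.apply_symm_apply x)
  continuous_toFun := continuous_rotate ρ
  continuous_invFun := continuous_rotate ρ.symm

open scoped Pointwise in
lemma measurePreserving_rotate (ρ : EuclideanSpace ℝ (Fin 3) ≃ₗᵢ[ℝ] EuclideanSpace ℝ (Fin 3)) :
    MeasurePreserving (rotate ρ) sphereMeasure sphereMeasure := by
  have hmeas := (continuous_rotate ρ).measurable
  refine ⟨hmeas, Measure.ext fun s hs => ?_⟩
  have hpreimage : ((↑) '' (rotate ρ ⁻¹' s) : Set (EuclideanSpace ℝ (Fin 3))) =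
      ρ.symm '' ((↑) '' s) := by
    rw [show rotate ρ ⁻¹' s = rotate ρ.symm '' s from
      ((rotateHomeomorph ρ).toEquiv.image_symm_eq_preimage s).symm, Set.image_image,
      Set.image_image]
    rfl
  have hcone : Set.Ioo (0 : ℝ) 1 • (ρ.symm '' ((↑) '' s)) =
      ρ ⁻¹' (Set.Ioo (0 : ℝ) 1 • ((↑) '' s)) := by
    rw [show ρ ⁻¹' _ = ρ.symm '' _ from (ρ.toEquiv.image_symm_eq_preimage _).symm]
    exact (Set.image_image2_distrib_right fun r v => ρ.symm.map_smul r v).symm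
  rw [Measure.map_apply hmeas hs, sphereMeasure, Measure.toSphere_apply' _ (hmeas hs),
    Measure.toSphere_apply' _ hs, hpreimage, hcone]
  exact congrArg _ (ρ.measurePreserving.measure_preimage_equiv (f := ρ.toMeasurableEquiv) _)

lemma integral_comp_rotate {E : Type*} [NormedAddCommGroup E] [NormedSpace ℝ E]
    (ρ : EuclideanSpace ℝ (Fin 3) ≃ₗᵢ[ℝ] EuclideanSpace ℝ (Fin 3)) (f : S2 → E) :
    ∫ x, f (rotate ρ x) ∂sphereMeasure = ∫ x, f x ∂sphereMeasure :=
  (measurePreserving_rotate ρ).integral_comp (rotateHomeomorph ρ).measurableEmbedding f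

lemma continuous_coord (i : Fin 3) : Continuous fun x : S2 => x.1 i := by fun_prop

lemma continuous_eval_axis (q : Polynomial ℝ) : Continuous fun x : S2 => q.eval (x.1 2) :=
  q.continuous.comp (continuous_coord 2)

@[fun_prop]
lemma continuous_dot : Continuous fun z : S2 × S2 => dot z.1 z.2 := by
  simp only [dot_eq]; fun_prop

/-! ### Orthogonality of Legendre kernels on the sphere -/

/-- The integral over the sphere of a polynomial in the last coordinate. -/
def axisIntegral : Polynomial ℝ →ₗ[ℝ] ℝ where
  toFun p := ∫ x, p.eval (x.1 2) ∂sphereMeasure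
  map_add' p q := by
    simp only [Polynomial.eval_add]
    exact integral_add (integrable_sphereMeasure_of_continuous (continuous_eval_axis p))
      (integrable_sphereMeasure_of_continuous (continuous_eval_axis q))
  map_smul' r p := by
    simp only [Polynomial.eval_smul, integral_smul, RingHom.id_apply]

lemma axisIntegral_apply (p : Polynomial ℝ) :
    axisIntegral p = ∫ x, p.eval (x.1 2) ∂sphereMeasure := rfl

lemma axisIntegral_one : axisIntegral 1 = 4 * Real.pi := by
  simp [axisIntegral_apply, sphereMeasure_real_univ]

/-- Rotation invariance, differentiated. -/
lemma integral_eq_zero_of_hasDerivAt_rotXZ {f f' : S2 → ℝ} (hf : Continuous f)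
    (hf' : Continuous f') (hderiv : ∀ x t, HasDerivAt (fun s => f (rotate (rotXZ s) x))
      (f' (rotate (rotXZ t) x)) t) :
    ∫ x, f' x ∂sphereMeasure = 0 := by
  obtain ⟨C, hC⟩ := isCompact_univ.exists_bound_of_continuousOn hf'.continuousOn
  have hintegral := (hasDerivAt_integral_of_dominated_loc_of_deriv_le (μ := sphereMeasure)
    (F := fun (t : ℝ) (x : S2) => f (rotate (rotXZ t) x))
    (F' := fun t x => f' (rotate (rotXZ t) x)) (x₀ := 0) (s := Set.univ) (bound := fun _ => C)
    univ_mem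
    (.of_forall fun t => (hf.comp (continuous_rotate _)).aestronglyMeasurable)
    (integrable_sphereMeasure_of_continuous (hf.comp (continuous_rotate _)))
    (hf'.comp (continuous_rotate _)).aestronglyMeasurable
    (.of_forall fun x t _ => hC _ (Set.mem_univ _))
    (integrable_const _)
    (.of_forall fun x t _ => hderiv x t)).2
  simp only [integral_comp_rotate] at hintegral
  exact hintegral.unique (hasDerivAt_const _ _)

lemma integral_sq_mul_derivative_sub_eq_zero (q : Polynomial ℝ) :
    ∫ x : S2, (x.1 0 ^ 2 * q.derivative.eval (x.1 2) - x.1 2 * q.eval (x.1 2)) ∂sphereMeasure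
      = 0 := by
  refine integral_eq_zero_of_hasDerivAt_rotXZ (f := fun x => x.1 0 * q.eval (x.1 2))
    ((continuous_coord 0).mul (continuous_eval_axis q))
    ((((continuous_coord 0).pow 2).mul (continuous_eval_axis q.derivative)).sub
      ((continuous_coord 2).mul (continuous_eval_axis q))) fun x t => ?_
  refine ((hasDerivAt_rotate_rotXZ_zero x t).mul ((q.hasDerivAt _).comp t
    (hasDerivAt_rotate_rotXZ_two x t))).congr_deriv ?_
  simp only [Function.comp_apply]
  ring

lemma integral_coord_one_sq_mul_axis (q : Polynomial ℝ) :
    ∫ x : S2, x.1 1 ^ 2 * q.eval (x.1 2) ∂sphereMeasure =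
      ∫ x : S2, x.1 0 ^ 2 * q.eval (x.1 2) ∂sphereMeasure := by
  rw [← integral_comp_rotate (rotXY (Real.pi / 2))]
  simp [rotate_rotXY_one, rotate_rotXY_two]

lemma isFlatFunctional_axisIntegral : IsFlatFunctional axisIntegral := by
  refine ⟨fun q => ?_⟩
  have hInt (i : Fin 3) : Integrable (fun x : S2 => x.1 i ^ 2 * q.derivative.eval (x.1 2))
      sphereMeasure := integrable_sphereMeasure_of_continuous
    (((continuous_coord i).pow 2).mul (continuous_eval_axis q.derivative))
  have hInt' : Integrable (fun x : S2 => x.1 2 * q.eval (x.1 2)) sphereMeasure :=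
    integrable_sphereMeasure_of_continuous ((continuous_coord 2).mul (continuous_eval_axis q))
  have hderiv (x : S2) : (Polynomial.derivative ((1 - Polynomial.X ^ 2) * q)).eval (x.1 2) =
      x.1 0 ^ 2 * q.derivative.eval (x.1 2) + x.1 1 ^ 2 * q.derivative.eval (x.1 2) -
        2 * (x.1 2 * q.eval (x.1 2)) := by
    simp only [Polynomial.derivative_mul, Polynomial.derivative_sub, Polynomial.derivative_one,
      Polynomial.derivative_X_pow, Polynomial.eval_add, Polynomial.eval_mul, Polynomial.eval_sub,
      Polynomial.eval_pow, Polynomial.eval_X, Polynomial.eval_one, Polynomial.eval_C,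
      Polynomial.eval_zero]
    push_cast
    linear_combination -q.derivative.eval (x.1 2) * sphere_sq_sum x
  have hrot := integral_sq_mul_derivative_sub_eq_zero q
  rw [integral_sub (hInt 0) hInt'] at hrot
  rw [axisIntegral_apply, integral_congr_ae (.of_forall hderiv),
    integral_sub ((hInt 0).fun_add (hInt 1)) (hInt'.const_mul 2), integral_add (hInt 0) (hInt 1),
    integral_coord_one_sq_mul_axis, integral_const_mul]
  linear_combination 2 * hrot

lemma continuous_harmonicProduct_right (ℓ m : ℕ) (x : S2) :
    Continuous (harmonicProduct ℓ m x) := by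
  unfold harmonicProduct rawHarmonic
  exact Complex.continuous_re.comp (continuous_const.mul (Complex.continuous_conj.comp
    ((by fun_prop : Continuous _).mul (Complex.continuous_ofReal.comp (continuous_eval_axis _)))))

lemma harmonicProduct_succ_rotXY_pi_div (ℓ m : ℕ) (x y : S2) :
    harmonicProduct ℓ (m + 1) x (rotate (rotXY (Real.pi / (m + 1 : ℝ))) y) =
      -harmonicProduct ℓ (m + 1) x y := by
  have hexp : Complex.exp ((Real.pi / (m + 1 : ℝ) : ℝ) * Complex.I) ^ (m + 1) = -1 := by
    have hne : (m : ℂ) + 1 ≠ 0 := by exact_mod_cast m.succ_ne_zero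
    rw [← Complex.exp_nat_mul, ← Complex.exp_pi_mul_I]
    congr 1
    push_cast
    field_simp
  simp only [harmonicProduct, rawHarmonic_rotXY, hexp, neg_mul, one_mul, map_neg, mul_neg,
    Complex.neg_re]

lemma integral_harmonicProduct_succ_mul_axis (ℓ m : ℕ) (q : Polynomial ℝ) (x : S2) :
    ∫ z : S2, harmonicProduct ℓ (m + 1) x z * q.eval (z.1 2) ∂sphereMeasure = 0 := by
  have h := integral_comp_rotate (rotXY (Real.pi / (m + 1 : ℝ)))
    fun z => harmonicProduct ℓ (m + 1) x z * q.eval (z.1 2)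
  simp only [harmonicProduct_succ_rotXY_pi_div, rotate_rotXY_two, neg_mul, integral_neg] at h
  linarith

lemma harmonicProduct_zero (ℓ : ℕ) (x y : S2) :
    harmonicProduct ℓ 0 x y = (legendreP ℓ).eval (x.1 2) * (legendreP ℓ).eval (y.1 2) := by
  simp [harmonicProduct, rawHarmonic]

/-- The Funk–Hecke formula for axially symmetric polynomials. -/
theorem integral_legendreP_mul_axis (ℓ : ℕ) (q : Polynomial ℝ) (x : S2) :
    ∫ z, (legendreP ℓ).eval (dot x z) * q.eval (z.1 2) ∂sphereMeasure =
      (legendreP ℓ).eval (x.1 2) * axisIntegral (legendreP ℓ * q) := by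
  have hexpand (z : S2) : (legendreP ℓ).eval (dot x z) * q.eval (z.1 2) =
      (legendreP ℓ).eval (x.1 2) * (legendreP ℓ * q).eval (z.1 2) +
        ∑ m ∈ Finset.range ℓ, 2 * harmonicWeight ℓ (m + 1) *
          (harmonicProduct ℓ (m + 1) x z * q.eval (z.1 2)) := by
    rw [← harmonicKernel_eq, harmonicKernel, harmonicProduct_zero, Polynomial.eval_mul, add_mul,
      Finset.sum_mul, mul_assoc]
    simp only [mul_assoc]
  have hInt (m : ℕ) : Integrable (fun z : S2 => 2 * harmonicWeight ℓ (m + 1) *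
      (harmonicProduct ℓ (m + 1) x z * q.eval (z.1 2))) sphereMeasure :=
    integrable_sphereMeasure_of_continuous (continuous_const.mul
      ((continuous_harmonicProduct_right ℓ (m + 1) x).mul (continuous_eval_axis q)))
  have hInt₀ : Integrable (fun z : S2 => (legendreP ℓ).eval (x.1 2) *
      (legendreP ℓ * q).eval (z.1 2)) sphereMeasure :=
    integrable_sphereMeasure_of_continuous (continuous_const.mul (continuous_eval_axis _))
  simp only [hexpand]
  rw [integral_add hInt₀ (integrable_finsetSum _ fun m _ => hInt m), integral_const_mul,
    integral_finsetSum _ fun m _ => hInt m]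
  simp only [integral_const_mul, integral_harmonicProduct_succ_mul_axis, mul_zero,
    Finset.sum_const_zero, add_zero, axisIntegral_apply]

@[fun_prop]
lemma continuous_legendreL (ℓ : ℕ) : Continuous (legendreL ℓ) :=
  continuous_const.mul (Polynomial.continuous _)

lemma legendreL_one (ℓ : ℕ) : legendreL ℓ 1 = (2 * (ℓ : ℝ) + 1) / (4 * Real.pi) := by
  rw [legendreL, legendreP_eval_one, mul_one]

lemma integral_legendreL_mul_legendreL_rotate (ℓ ℓ' : ℕ)
    (ρ : EuclideanSpace ℝ (Fin 3) ≃ₗᵢ[ℝ] EuclideanSpace ℝ (Fin 3)) (x y : S2) :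
    ∫ z, legendreL ℓ (dot (rotate ρ x) z) * legendreL ℓ' (dot z (rotate ρ y)) ∂sphereMeasure =
      ∫ z, legendreL ℓ (dot x z) * legendreL ℓ' (dot z y) ∂sphereMeasure := by
  rw [← integral_comp_rotate ρ]
  simp only [dot_rotate]

lemma integral_legendreL_mul_legendreL_northPole (ℓ ℓ' : ℕ) (x : S2) :
    ∫ z, legendreL ℓ (dot x z) * legendreL ℓ' (dot z northPole) ∂sphereMeasure =
      if ℓ = ℓ' then legendreL ℓ (dot x northPole) else 0 := by
  simp only [dot_northPole, legendreL, mul_mul_mul_comm _ (Polynomial.eval _ _)]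
  rw [integral_const_mul, integral_legendreP_mul_axis]
  split_ifs with h
  · subst h
    have hself := isFlatFunctional_axisIntegral.legendreP_mul_self ℓ
    rw [axisIntegral_one] at hself
    have hpi := Real.pi_pos.ne'
    field_simp
    linear_combination (legendreP ℓ).eval (x.1 2) * hself
  · rw [isFlatFunctional_axisIntegral.legendreP_mul_eq_zero h, mul_zero, mul_zero]

theorem integral_legendreL_mul_legendreL (ℓ ℓ' : ℕ) (x y : S2) :
    ∫ z, legendreL ℓ (dot x z) * legendreL ℓ' (dot z y) ∂sphereMeasure =
      if ℓ = ℓ' then legendreL ℓ (dot x y) else 0 := by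
  obtain ⟨θ, φ, h⟩ := exists_rotXZ_rotXY_eq_northPole y
  rw [← integral_legendreL_mul_legendreL_rotate ℓ ℓ' (rotXY θ),
    ← integral_legendreL_mul_legendreL_rotate ℓ ℓ' (rotXZ φ), ← dot_rotate (rotXY θ) x y,
    ← dot_rotate (rotXZ φ), h, integral_legendreL_mul_legendreL_northPole]

/-! ### Zonal kernels -/

/-- The zonal function `∑_{ℓ < n} c_ℓ L_ℓ`. -/
def zonal (n : ℕ) (c : ℕ → ℝ) (u : ℝ) : ℝ := ∑ ℓ ∈ Finset.range n, c ℓ * legendreL ℓ u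

@[fun_prop]
lemma continuous_zonal (n : ℕ) (c : ℕ → ℝ) : Continuous (zonal n c) :=
  continuous_finsetSum _ fun ℓ _ => continuous_const.mul (continuous_legendreL ℓ)

lemma integral_zonal_mul_zonal (n : ℕ) (c d : ℕ → ℝ) (x y : S2) :
    ∫ z, zonal n c (dot x z) * zonal n d (dot z y) ∂sphereMeasure =
      zonal n (fun ℓ => c ℓ * d ℓ) (dot x y) := by
  have hInt (ℓ ℓ' : ℕ) : Integrable
      (fun z => c ℓ * d ℓ' * (legendreL ℓ (dot x z) * legendreL ℓ' (dot z y))) sphereMeasure :=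
    integrable_sphereMeasure_of_continuous (by fun_prop)
  simp only [zonal, Finset.sum_mul_sum, mul_mul_mul_comm (c _) (legendreL _ _)]
  rw [integral_finsetSum _ fun ℓ _ => integrable_finsetSum _ fun ℓ' _ => hInt ℓ ℓ']
  refine Finset.sum_congr rfl fun ℓ hℓ => ?_
  rw [integral_finsetSum _ fun ℓ' _ => hInt ℓ ℓ']
  simp only [integral_const_mul, integral_legendreL_mul_legendreL, mul_ite, mul_zero,
    Finset.sum_ite_eq, if_pos hℓ]

/-! ### Cubature of zonal kernels -/

section HarmonicDecomposition

open MvPolynomial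

/-- The polynomial `X₀² + X₁² + X₂²`. -/
def radiusSq : MvPolynomial (Fin 3) ℂ := X 0 ^ 2 + X 1 ^ 2 + X 2 ^ 2

lemma pderiv_radiusSq (i : Fin 3) : pderiv i radiusSq = 2 * X i := by
  fin_cases i <;> simp [radiusSq, pderiv_X]

lemma isHomogeneous_radiusSq : radiusSq.IsHomogeneous 2 :=
  (((isHomogeneous_X ℂ 0).pow 2).add ((isHomogeneous_X ℂ 1).pow 2)).add
    ((isHomogeneous_X ℂ 2).pow 2)

lemma polyLaplacian_apply (p : MvPolynomial (Fin 3) ℂ) : polyLaplacian p =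
    pderiv 0 (pderiv 0 p) + pderiv 1 (pderiv 1 p) + pderiv 2 (pderiv 2 p) := by
  simp [polyLaplacian, Fin.sum_univ_three]

lemma isHomogeneous_polyLaplacian {p : MvPolynomial (Fin 3) ℂ} {d : ℕ} (hp : p.IsHomogeneous d) :
    (polyLaplacian p).IsHomogeneous (d - 1 - 1) := by
  rw [polyLaplacian_apply]
  exact (hp.pderiv.pderiv.add hp.pderiv.pderiv).add hp.pderiv.pderiv

lemma polyLaplacian_eq_zero_of_isHomogeneous {p : MvPolynomial (Fin 3) ℂ} {d : ℕ}
    (hp : p.IsHomogeneous d) (hd : d < 2) : polyLaplacian p = 0 := by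
  have hpderiv (i : Fin 3) : pderiv i (pderiv i p) = 0 := by
    have hzero : (pderiv i p).IsHomogeneous 0 := by
      simpa only [Nat.sub_eq_zero_of_le (Nat.lt_succ_iff.mp hd)] using hp.pderiv (i := i)
    rw [← totalDegree_zero_iff_isHomogeneous, totalDegree_eq_zero_iff_eq_C] at hzero
    rw [hzero, pderiv_C]
  simp only [polyLaplacian_apply, hpderiv, add_zero]

lemma polyLaplacian_radiusSq_mul {p : MvPolynomial (Fin 3) ℂ} {d : ℕ} (hp : p.IsHomogeneous d) :
    polyLaplacian (radiusSq * p) = (6 + 4 * (d : MvPolynomial (Fin 3) ℂ)) * p +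
      radiusSq * polyLaplacian p := by
  have heuler := hp.sum_X_mul_pderiv
  rw [Fin.sum_univ_three, nsmul_eq_mul] at heuler
  have htwo (i : Fin 3) : pderiv i (2 : MvPolynomial (Fin 3) ℂ) = 0 :=
    (pderiv i).map_natCast 2
  simp only [polyLaplacian_apply, pderiv_mul, map_add, pderiv_radiusSq, pderiv_X_self, htwo]
  linear_combination 4 * heuler

/-- The space of harmonic homogeneous polynomials of degree `d`, which `harmonicSpace` restricts
to the sphere. -/
def harmonicPoly (d : ℕ) : Submodule ℂ (MvPolynomial (Fin 3) ℂ) :=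
  homogeneousSubmodule (Fin 3) ℂ d ⊓ LinearMap.ker polyLaplacian

lemma isHomogeneous_radiusSq_pow_mul {h : MvPolynomial (Fin 3) ℂ} {d : ℕ}
    (hh : h.IsHomogeneous d) (i : ℕ) : (radiusSq ^ i * h).IsHomogeneous (2 * i + d) :=
  (isHomogeneous_radiusSq.pow i).mul hh

lemma polyLaplacian_radiusSq_pow_mul {h : MvPolynomial (Fin 3) ℂ} {d : ℕ}
    (hh : h ∈ harmonicPoly d) (i : ℕ) : polyLaplacian (radiusSq ^ (i + 1) * h) =
      ((2 * (i + 1) * (2 * i + 3 + 2 * d) : ℕ) : ℂ) • (radiusSq ^ i * h) := by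
  have hhom : h.IsHomogeneous d := (mem_homogeneousSubmodule d h).mp hh.1
  have hker : polyLaplacian h = 0 := hh.2
  induction i with
  | zero =>
    rw [zero_add, pow_one, polyLaplacian_radiusSq_mul hhom, hker, pow_zero, smul_eq_C_mul,
      map_natCast]
    push_cast
    ring
  | succ i ih =>
    rw [pow_succ', mul_assoc, polyLaplacian_radiusSq_mul (isHomogeneous_radiusSq_pow_mul hhom _),
      ih, smul_eq_C_mul, smul_eq_C_mul, map_natCast, map_natCast]
    push_cast
    ring

/-- The span of the homogeneous polynomials of degree `k` of the form `|X|^{2i} h` with `h`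
harmonic; these are in fact all homogeneous polynomials of degree `k`. -/
def radialHarmonicSpan (k : ℕ) : Submodule ℂ (MvPolynomial (Fin 3) ℂ) :=
  Submodule.span ℂ {p | ∃ (i d : ℕ) (h : MvPolynomial (Fin 3) ℂ), 2 * i + d = k ∧
    h ∈ harmonicPoly d ∧ p = radiusSq ^ i * h}

lemma harmonicPoly_le_radialHarmonicSpan (k : ℕ) : harmonicPoly k ≤ radialHarmonicSpan k :=
  fun h hh => Submodule.subset_span ⟨0, k, h, by lia, hh, by simp⟩

lemma radialHarmonicSpan_le_homogeneousSubmodule (k : ℕ) :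
    radialHarmonicSpan k ≤ homogeneousSubmodule (Fin 3) ℂ k := by
  refine Submodule.span_le.mpr ?_
  rintro _ ⟨i, d, h, rfl, hh, rfl⟩
  exact isHomogeneous_radiusSq_pow_mul ((mem_homogeneousSubmodule d h).mp hh.1) i

lemma radialHarmonicSpan_le_map_polyLaplacian (k : ℕ) :
    radialHarmonicSpan k ≤ (radialHarmonicSpan (k + 2)).map polyLaplacian := by
  refine Submodule.span_le.mpr ?_
  rintro _ ⟨i, d, h, hk, hh, rfl⟩
  refine ⟨((2 * (i + 1) * (2 * i + 3 + 2 * d) : ℕ) : ℂ)⁻¹ • (radiusSq ^ (i + 1) * h),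
    Submodule.smul_mem _ _ (Submodule.subset_span ⟨i + 1, d, h, by lia, hh, rfl⟩), ?_⟩
  rw [map_smul, polyLaplacian_radiusSq_pow_mul hh, smul_smul, inv_mul_cancel₀, one_smul]
  rw [Nat.cast_ne_zero]
  positivity

/-- By induction the Laplacian of `p` is the Laplacian of some `q` in the span, and `p - q` is
harmonic. -/
lemma homogeneousSubmodule_le_radialHarmonicSpan (k : ℕ) :
    homogeneousSubmodule (Fin 3) ℂ k ≤ radialHarmonicSpan k := by
  induction k using Nat.strong_induction_on with
  | _ k ih =>
    intro p hp
    have hhom : p.IsHomogeneous k := (mem_homogeneousSubmodule k p).mp hp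
    rcases lt_or_ge k 2 with hk | hk
    · exact harmonicPoly_le_radialHarmonicSpan k
        ⟨hp, polyLaplacian_eq_zero_of_isHomogeneous hhom hk⟩
    · obtain ⟨n, rfl⟩ := Nat.exists_eq_add_of_le' hk
      obtain ⟨q, hq, hqp⟩ := radialHarmonicSpan_le_map_polyLaplacian n
        (ih n (by lia) ((mem_homogeneousSubmodule n _).mpr (isHomogeneous_polyLaplacian hhom)))
      have hdiff : p - q ∈ harmonicPoly (n + 2) :=
        ⟨Submodule.sub_mem _ hp (radialHarmonicSpan_le_homogeneousSubmodule _ hq),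
          LinearMap.sub_mem_ker_iff.mpr hqp.symm⟩
      simpa only [sub_add_cancel] using
        Submodule.add_mem _ (harmonicPoly_le_radialHarmonicSpan _ hdiff) hq

lemma restrictToSphere_mul (p q : MvPolynomial (Fin 3) ℂ) :
    restrictToSphere (p * q) = restrictToSphere p * restrictToSphere q := by
  funext x; simp [restrictToSphere]

lemma restrictToSphere_radiusSq_pow_mul (i : ℕ) (h : MvPolynomial (Fin 3) ℂ) :
    restrictToSphere (radiusSq ^ i * h) = restrictToSphere h := by
  funext x
  have hx := congrArg (fun r : ℝ => (r : ℂ)) (sphere_sq_sum x)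
  push_cast at hx
  simp [restrictToSphere, radiusSq, hx]

lemma radialHarmonicSpan_le_comap_restrictToSphere {k n : ℕ} (hk : k ≤ n) :
    radialHarmonicSpan k ≤ (⨆ ℓ ∈ Set.Iic n, harmonicSpace ℓ).comap restrictToSphere := by
  refine Submodule.span_le.mpr ?_
  rintro _ ⟨i, d, h, hd, hh, rfl⟩
  rw [SetLike.mem_coe, Submodule.mem_comap, restrictToSphere_radiusSq_pow_mul]
  exact Submodule.mem_iSup_of_mem d (Submodule.mem_iSup_of_mem
    (Set.mem_Iic.mpr (by lia)) ⟨h, hh, rfl⟩)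

lemma restrictToSphere_mem_iSup_harmonicSpace {p : MvPolynomial (Fin 3) ℂ} {n : ℕ}
    (hp : p.totalDegree ≤ n) : restrictToSphere p ∈ ⨆ ℓ ∈ Set.Iic n, harmonicSpace ℓ := by
  rw [← sum_homogeneousComponent p, map_sum]
  exact Submodule.sum_mem _ fun k hk =>
    radialHarmonicSpan_le_comap_restrictToSphere (by rw [Finset.mem_range] at hk; lia)
      (homogeneousSubmodule_le_radialHarmonicSpan k
        ((mem_homogeneousSubmodule k _).mpr (homogeneousComponent_isHomogeneous k p)))

lemma exists_restrictToSphere_eq_eval_dot (q : Polynomial ℝ) (x : S2) :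
    ∃ p : MvPolynomial (Fin 3) ℂ, p.totalDegree ≤ q.natDegree ∧
      restrictToSphere p = fun z => ((q.eval (dot x z) : ℝ) : ℂ) := by
  let lin : MvPolynomial (Fin 3) ℂ := ∑ i : Fin 3, C (x.1 i : ℂ) * X i
  have hdegree : lin.totalDegree ≤ 1 :=
    totalDegree_finsetSum_le fun i _ => (isHomogeneous_C_mul_X (x.1 i : ℂ) i).totalDegree_le
  have heval (z : S2) : eval (fun i : Fin 3 => ((z.1 i : ℝ) : ℂ)) lin = ((dot x z : ℝ) : ℂ) := by
    simp [lin, dot_eq, Fin.sum_univ_three]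
  refine ⟨∑ i ∈ Finset.range (q.natDegree + 1), C (q.coeff i : ℂ) * lin ^ i,
    totalDegree_finsetSum_le fun i hi => ?_, funext fun z => ?_⟩
  · calc (C (q.coeff i : ℂ) * lin ^ i).totalDegree
        ≤ (C (q.coeff i : ℂ) : MvPolynomial (Fin 3) ℂ).totalDegree + i * lin.totalDegree :=
          (totalDegree_mul _ _).trans (add_le_add_right (totalDegree_pow _ _) _)
      _ ≤ 0 + i * 1 := by rw [totalDegree_C]; gcongr
      _ ≤ q.natDegree := by rw [Finset.mem_range] at hi; lia
  · simp [restrictToSphere, heval, Polynomial.eval_eq_sum_range]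

end HarmonicDecomposition

section Cubature

variable {c₀ : ℝ} {L N : ℕ} {ξ : Fin N → S2} {lam : Fin N → ℝ}

lemma IsPixelization.sum_eval_dot_mul_eval_dot (h : IsPixelization c₀ L N ξ lam)
    {p q : Polynomial ℝ} (hpq : p.natDegree + q.natDegree ≤ L) (x y : S2) :
    ∑ k, lam k * (p.eval (dot x (ξ k)) * q.eval (dot (ξ k) y)) =
      ∫ z, p.eval (dot x z) * q.eval (dot z y) ∂sphereMeasure := by
  obtain ⟨p', hp', hpx⟩ := exists_restrictToSphere_eq_eval_dot p x
  obtain ⟨q', hq', hqy⟩ := exists_restrictToSphere_eq_eval_dot q y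
  have hcub := h.cubature _ (restrictToSphere_mem_iSup_harmonicSpace (p := p' * q')
    ((MvPolynomial.totalDegree_mul _ _).trans (by lia)))
  rw [restrictToSphere_mul, hpx, hqy] at hcub
  simp only [Pi.mul_apply, ← Complex.ofReal_mul, integral_complex_ofReal, ← Complex.ofReal_sum]
    at hcub
  simp only [dot_comm _ y]
  exact_mod_cast hcub.symm

/-- The polynomial underlying the zonal function `zonal n c`. -/
def zonalPoly (n : ℕ) (c : ℕ → ℝ) : Polynomial ℝ :=
  ∑ ℓ ∈ Finset.range n,
    Polynomial.C (c ℓ * ((2 * (ℓ : ℝ) + 1) / (4 * Real.pi))) * legendreP ℓ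

lemma zonalPoly_eval (n : ℕ) (c : ℕ → ℝ) (u : ℝ) : (zonalPoly n c).eval u = zonal n c u := by
  simp [zonalPoly, zonal, Polynomial.eval_finsetSum, legendreL, mul_assoc]

lemma natDegree_zonalPoly_succ_le (n : ℕ) (c : ℕ → ℝ) : (zonalPoly (n + 1) c).natDegree ≤ n :=
  Polynomial.natDegree_sum_le_of_forall_le _ _ fun ℓ hℓ =>
    (Polynomial.natDegree_C_mul_le _ _).trans
      (by rw [natDegree_legendreP]; exact Nat.lt_succ_iff.mp (Finset.mem_range.mp hℓ))

lemma IsPixelization.sum_zonal_mul_zonal {n : ℕ} (h : IsPixelization c₀ L N ξ lam)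
    (hn : 2 * n ≤ L) (c d : ℕ → ℝ) (x y : S2) :
    ∑ k, lam k * (zonal (n + 1) c (dot x (ξ k)) * zonal (n + 1) d (dot (ξ k) y)) =
      zonal (n + 1) (fun ℓ => c ℓ * d ℓ) (dot x y) := by
  rw [← integral_zonal_mul_zonal]
  simp only [← zonalPoly_eval]
  refine h.sum_eval_dot_mul_eval_dot ?_ x y
  linarith [natDegree_zonalPoly_succ_le n c, natDegree_zonalPoly_succ_le n d]

lemma IsPixelization.sum_weight (h : IsPixelization c₀ L N ξ lam) :
    ∑ k, lam k = 4 * Real.pi := by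
  simpa [sphereMeasure_real_univ] using
    h.sum_eval_dot_mul_eval_dot (p := 1) (q := 1) (by simp) northPole northPole

end Cubature

/-! ### Integrals of a random field -/

section RandomField

lemma exists_forall_norm_le_of_continuous {T E : Type*} [TopologicalSpace T] [CompactSpace T]
    [SeminormedAddGroup E] {f : T → E} (hf : Continuous f) : ∃ C, ∀ x, ‖f x‖ ≤ C := by
  obtain ⟨C, hC⟩ := isCompact_univ.exists_bound_of_continuousOn hf.continuousOn
  exact ⟨C, fun x => hC x (Set.mem_univ x)⟩

lemma integrable_mul_of_continuous {T E : Type*} [TopologicalSpace T] [CompactSpace T]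
    [MeasurableSpace T] [OpensMeasurableSpace T] {μ : Measure T} [NormedRing E]
    [SecondCountableTopology E] {g f : T → E} (hg : Integrable g μ) (hf : Continuous f) :
    Integrable (fun y => g y * f y) μ := by
  obtain ⟨C, hC⟩ := exists_forall_norm_le_of_continuous hf
  exact hg.mul_bdd hf.aestronglyMeasurable (Eventually.of_forall hC)

variable {T Ω : Type*} [MeasurableSpace T] {μ : Measure T} {X : T → Ω → ℝ}

/-- The integral of a random field against a function, as a random variable. -/
def fieldIntegral (μ : Measure T) (X : T → Ω → ℝ) (f : T → ℝ) (ω : Ω) : ℝ :=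
  ∫ y, X y ω * f y ∂μ

lemma fieldIntegral_mul_fieldIntegral [SFinite μ] (f g : T → ℝ) (ω : Ω) :
    fieldIntegral μ X f ω * fieldIntegral μ X g ω =
      ∫ z, X z.1 ω * X z.2 ω * (f z.1 * g z.2) ∂(μ.prod μ) := by
  rw [fieldIntegral, fieldIntegral, ← integral_prod_mul]
  exact integral_congr_ae (Eventually.of_forall fun z => by ring)

lemma fieldIntegral_sum [TopologicalSpace T] [CompactSpace T] [OpensMeasurableSpace T] {ω : Ω}
    (hω : Integrable (fun y => X y ω) μ) {ι : Type*} (s : Finset ι) (c : ι → ℝ) {f : ι → T → ℝ}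
    (hf : ∀ i ∈ s, Continuous (f i)) :
    fieldIntegral μ X (fun y => ∑ i ∈ s, c i * f i y) ω =
      ∑ i ∈ s, c i * fieldIntegral μ X (f i) ω := by
  simp only [fieldIntegral, Finset.mul_sum, mul_left_comm _ (c _), ← integral_const_mul]
  exact integral_finsetSum _ fun i hi => (integrable_mul_of_continuous hω (hf i hi)).const_mul _

variable [MeasurableSpace Ω] {P : Measure Ω}

/-- The second moment function `(x, y) ↦ E[X_x X_y]` of a random field, which is its covariance
function when the field is centered. -/
def fieldCov (X : T → Ω → ℝ) (P : Measure Ω) (z : T × T) : ℝ := ∫ ω, X z.1 ω * X z.2 ω ∂P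

/-- The integral of a kernel against the second moment function of a random field. -/
def covIntegral (μ : Measure T) (X : T → Ω → ℝ) (P : Measure Ω) (k : T × T → ℝ) : ℝ :=
  ∫ z, fieldCov X P z * k z ∂(μ.prod μ)

variable [IsFiniteMeasure μ] [SFinite P]

lemma integrable_field_mul_field (hX : MemLp (fun z : T × Ω => X z.1 z.2) 2 (μ.prod P)) :
    Integrable (fun w : (T × T) × Ω => X w.1.1 w.2 * X w.1.2 w.2) ((μ.prod μ).prod P) := by
  have hassoc := measurePreserving_prodAssoc μ μ P
  have hfst : MemLp (fun w : (T × T) × Ω => X w.1.1 w.2) 2 ((μ.prod μ).prod P) :=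
    (hX.comp_fst μ).comp_measurePreserving (((measurePreserving_prodAssoc μ P μ).symm _).comp
      (((MeasurePreserving.id μ).prod Measure.measurePreserving_swap).comp hassoc))
  have hsnd : MemLp (fun w : (T × T) × Ω => X w.1.2 w.2) 2 ((μ.prod μ).prod P) :=
    (hX.comp_snd μ).comp_measurePreserving hassoc
  exact hfst.integrable_mul hsnd

lemma ae_integrable_field [IsFiniteMeasure P]
    (hX : MemLp (fun z : T × Ω => X z.1 z.2) 2 (μ.prod P)) :
    ∀ᵐ ω ∂P, Integrable (fun y => X y ω) μ :=
  (hX.integrable one_le_two).prod_left_ae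

variable [TopologicalSpace T] [CompactSpace T] [OpensMeasurableSpace T]

lemma integral_fieldIntegral_mul_eq_zero
    (hX : MemLp (fun z : T × Ω => X z.1 z.2) 2 (μ.prod P)) {f : T → ℝ} (hf : Continuous f)
    {V : Ω → ℝ} (hV : MemLp V 2 P) (hXV : ∀ y, ∫ ω, X y ω * V ω ∂P = 0) :
    ∫ ω, fieldIntegral μ X f ω * V ω ∂P = 0 := by
  obtain ⟨C, hC⟩ := exists_forall_norm_le_of_continuous hf
  have hInt : Integrable (fun z : T × Ω => f z.1 * (X z.1 z.2 * V z.2)) (μ.prod P) :=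
    (hX.integrable_mul (hV.comp_snd μ)).bdd_mul
      (hf.measurable.comp measurable_fst).aestronglyMeasurable
      (Eventually.of_forall fun z => hC z.1)
  have hpath : ∀ ω, fieldIntegral μ X f ω * V ω = ∫ y, f y * (X y ω * V ω) ∂μ := fun ω => by
    rw [fieldIntegral, ← integral_mul_const]
    exact integral_congr_ae (Eventually.of_forall fun y => by ring)
  simp only [hpath]
  rw [← integral_integral_swap (f := fun y ω => f y * (X y ω * V ω)) hInt]
  simp only [integral_const_mul, hXV, mul_zero, integral_zero]

variable [SecondCountableTopology T]

lemma integrable_field_mul_field_mul_kernel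
    (hX : MemLp (fun z : T × Ω => X z.1 z.2) 2 (μ.prod P)) {k : T × T → ℝ} (hk : Continuous k) :
    Integrable (fun w : (T × T) × Ω => X w.1.1 w.2 * X w.1.2 w.2 * k w.1)
      ((μ.prod μ).prod P) := by
  obtain ⟨C, hC⟩ := exists_forall_norm_le_of_continuous hk
  exact (integrable_field_mul_field hX).mul_bdd
    (hk.measurable.comp measurable_fst).aestronglyMeasurable (Eventually.of_forall fun w => hC w.1)

lemma integrable_fieldCov_mul (hX : MemLp (fun z : T × Ω => X z.1 z.2) 2 (μ.prod P))
    {k : T × T → ℝ} (hk : Continuous k) :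
    Integrable (fun z => fieldCov X P z * k z) (μ.prod μ) := by
  simpa only [fieldCov, integral_mul_const] using
    (integrable_field_mul_field_mul_kernel hX hk).integral_prod_left

lemma integral_pairing_eq_covIntegral (hX : MemLp (fun z : T × Ω => X z.1 z.2) 2 (μ.prod P))
    {k : T × T → ℝ} (hk : Continuous k) :
    ∫ ω, ∫ z, X z.1 ω * X z.2 ω * k z ∂(μ.prod μ) ∂P = covIntegral μ X P k := by
  simp only [covIntegral, fieldCov, ← integral_mul_const]
  exact (integral_integral_swap (f := fun (z : T × T) (ω : Ω) => X z.1 ω * X z.2 ω * k z)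
    (integrable_field_mul_field_mul_kernel hX hk)).symm

lemma covIntegral_sum (hX : MemLp (fun z : T × Ω => X z.1 z.2) 2 (μ.prod P)) {ι : Type*}
    (s : Finset ι) (c : ι → ℝ) {k : ι → T × T → ℝ} (hk : ∀ i ∈ s, Continuous (k i)) :
    covIntegral μ X P (fun z => ∑ i ∈ s, c i * k i z) =
      ∑ i ∈ s, c i * covIntegral μ X P (k i) := by
  simp only [covIntegral, Finset.mul_sum, mul_left_comm _ (c _), ← integral_const_mul]
  exact integral_finsetSum _ fun i hi => (integrable_fieldCov_mul hX (hk i hi)).const_mul _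

lemma integral_fieldIntegral_sq (hX : MemLp (fun z : T × Ω => X z.1 z.2) 2 (μ.prod P))
    {f : T → ℝ} (hf : Continuous f) :
    ∫ ω, fieldIntegral μ X f ω ^ 2 ∂P = covIntegral μ X P (fun z => f z.1 * f z.2) := by
  simp only [sq, fieldIntegral_mul_fieldIntegral]
  exact integral_pairing_eq_covIntegral hX (by fun_prop)

lemma memLp_fieldIntegral (hX : MemLp (fun z : T × Ω => X z.1 z.2) 2 (μ.prod P)) {f : T → ℝ}
    (hf : Continuous f) : MemLp (fieldIntegral μ X f) 2 P := by
  refine (memLp_two_iff_integrable_sq ?_).mpr ?_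
  · exact (hX.aestronglyMeasurable.mul
      (hf.measurable.comp measurable_fst).aestronglyMeasurable).prod_swap.integral_prod_right'
  · simp only [sq, fieldIntegral_mul_fieldIntegral]
    exact (integrable_field_mul_field_mul_kernel hX
      (k := fun z => f z.1 * f z.2) (by fun_prop)).integral_prod_right

end RandomField

/-! ### Harmonic coefficients -/

section HarmonicCoefficients

variable {Ω : Type*} {X : S2 → Ω → ℝ} {ω : Ω}

lemma continuous_sphericalHarmonic (ℓ : ℕ) (m : ℤ) : Continuous (sphericalHarmonic ℓ m) := by
  unfold sphericalHarmonic
  exact Continuous.mul (by fun_prop)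
    (Complex.continuous_ofReal.comp ((Polynomial.continuous _).comp (continuous_coord 2)))

lemma sum_harmonicCoeff_mul_sphericalHarmonic (hω : Integrable (fun y => X y ω) sphereMeasure)
    (ℓ : ℕ) (x : S2) :
    ∑ m ∈ Finset.Icc (-(ℓ : ℤ)) ℓ, harmonicCoeff X ℓ m ω * sphericalHarmonic ℓ m x =
      (fieldIntegral sphereMeasure X (fun y => legendreL ℓ (dot x y)) ω : ℂ) := by
  have hInt (m : ℤ) : Integrable (fun y => (X y ω : ℂ) * (starRingEnd ℂ)
      (sphericalHarmonic ℓ m y) * sphericalHarmonic ℓ m x) sphereMeasure :=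
    (integrable_mul_of_continuous hω.ofReal
      (Complex.continuous_conj.comp (continuous_sphericalHarmonic ℓ m))).mul_const _
  simp only [harmonicCoeff, fieldIntegral, ← integral_mul_const, ← integral_complex_ofReal]
  rw [← integral_finsetSum _ fun m _ => hInt m]
  refine integral_congr_ae (Eventually.of_forall fun y => ?_)
  simp only [Complex.ofReal_mul, ← sum_sphericalHarmonic_mul_conj, Finset.mul_sum]
  exact Finset.sum_congr rfl fun m _ => by ring

lemma conj_harmonicCoeff (X : S2 → Ω → ℝ) (ℓ : ℕ) (m : ℤ) (ω : Ω) :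
    (starRingEnd ℂ) (harmonicCoeff X ℓ m ω) =
      ∫ x, (X x ω : ℂ) * sphericalHarmonic ℓ m x ∂sphereMeasure := by
  simp [harmonicCoeff, ← integral_conj]

lemma sum_norm_harmonicCoeff_sq (hω : Integrable (fun y => X y ω) sphereMeasure) (ℓ : ℕ) :
    ∑ m ∈ Finset.Icc (-(ℓ : ℤ)) ℓ, ‖harmonicCoeff X ℓ m ω‖ ^ 2 =
      ∫ z, X z.1 ω * X z.2 ω * legendreL ℓ (dot z.1 z.2) ∂(sphereMeasure.prod sphereMeasure) := by
  have hInt (m : ℤ) : Integrable (fun x => harmonicCoeff X ℓ m ω *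
      ((X x ω : ℂ) * sphericalHarmonic ℓ m x)) sphereMeasure :=
    (integrable_mul_of_continuous hω.ofReal (continuous_sphericalHarmonic ℓ m)).const_mul _
  have hkernel : Continuous fun z : S2 × S2 => legendreL ℓ (dot z.1 z.2) := by fun_prop
  rw [integral_prod _ (integrable_mul_of_continuous (hω.mul_prod hω) hkernel)]
  apply Complex.ofReal_injective
  simp only [Complex.ofReal_sum, Complex.ofReal_pow, ← Complex.mul_conj', conj_harmonicCoeff,
    ← integral_const_mul]
  rw [← integral_finsetSum _ fun m _ => hInt m, ← integral_complex_ofReal]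
  refine integral_congr_ae (Eventually.of_forall fun x => ?_)
  simp only [mul_left_comm _ (X x ω : ℂ), ← Finset.mul_sum, mul_assoc, integral_const_mul,
    Complex.ofReal_mul]
  rw [sum_harmonicCoeff_mul_sphericalHarmonic hω, fieldIntegral]

variable [MeasurableSpace Ω] {P : Measure Ω}

lemma powerSpectrum_nonneg (X : S2 → Ω → ℝ) (P : Measure Ω) (ℓ : ℕ) : 0 ≤ powerSpectrum X P ℓ :=
  mul_nonneg (by positivity) (Finset.sum_nonneg fun _ _ => integral_nonneg fun _ => sq_nonneg _)

lemma two_mul_add_one_mul_powerSpectrum [IsFiniteMeasure P]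
    (hX : MemLp (fun z : S2 × Ω => X z.1 z.2) 2 (sphereMeasure.prod P)) (ℓ : ℕ) :
    (2 * (ℓ : ℝ) + 1) * powerSpectrum X P ℓ =
      covIntegral sphereMeasure X P (fun z => legendreL ℓ (dot z.1 z.2)) := by
  have hkernel : Continuous fun z : S2 × S2 => legendreL ℓ (dot z.1 z.2) := by fun_prop
  have hsum := (ae_integrable_field hX).mono fun ω hω => sum_norm_harmonicCoeff_sq hω ℓ
  have hmeas (m : ℤ) : AEStronglyMeasurable (harmonicCoeff X ℓ m) P :=
    ((Complex.continuous_ofReal.comp_aestronglyMeasurable hX.aestronglyMeasurable).mul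
      ((Complex.continuous_conj.comp (continuous_sphericalHarmonic ℓ m)).measurable.comp
        measurable_fst).aestronglyMeasurable).prod_swap.integral_prod_right'
  have hInt : ∀ m ∈ Finset.Icc (-(ℓ : ℤ)) ℓ,
      Integrable (fun ω => ‖harmonicCoeff X ℓ m ω‖ ^ 2) P := fun m hm => by
    refine (integrable_field_mul_field_mul_kernel hX hkernel).integral_prod_right.mono'
      ((hmeas m).norm.pow 2) (hsum.mono fun ω hω => ?_)
    rw [Real.norm_of_nonneg (sq_nonneg _), ← hω]
    exact Finset.single_le_sum (fun m _ => sq_nonneg ‖harmonicCoeff X ℓ m ω‖) hm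
  rw [powerSpectrum, ← integral_finsetSum _ hInt, integral_congr_ae hsum,
    integral_pairing_eq_covIntegral hX hkernel, one_div, mul_inv_cancel_left₀ (by positivity)]

end HarmonicCoefficients

/-! ### Stationary fields -/

section Stationary

variable {Ω : Type*} [MeasurableSpace Ω] {P : Measure Ω} {X : S2 → Ω → ℝ}

/-- A random field on the sphere that is jointly measurable, square integrable and second-order
stationary: the part of `IsStationaryGaussianField` that determines the mean of a quadratic
estimator. -/
structure IsStationaryField (X : S2 → Ω → ℝ) (P : Measure Ω) : Prop where
  measurable : Measurable (fun z : S2 × Ω => X z.1 z.2)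
  memLp : ∀ x, MemLp (X x) 2 P
  stationary : ∀ ρ, IsRotation ρ → ∀ x y,
    ∫ ω, X (rotate ρ x) ω * X (rotate ρ y) ω ∂P = ∫ ω, X x ω * X y ω ∂P

lemma IsStationaryGaussianField.isStationaryField (hX : IsStationaryGaussianField X P) :
    IsStationaryField X P :=
  ⟨hX.measurable, hX.memLp, hX.stationary⟩

namespace IsStationaryField

lemma fieldCov_rotate (hX : IsStationaryField X P)
    {ρ : EuclideanSpace ℝ (Fin 3) ≃ₗᵢ[ℝ] EuclideanSpace ℝ (Fin 3)} (hρ : IsRotation ρ) :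
    fieldCov (fun x => X (rotate ρ x)) P = fieldCov X P :=
  funext fun z => hX.stationary ρ hρ z.1 z.2

lemma comp_rotate (hX : IsStationaryField X P)
    {ρ : EuclideanSpace ℝ (Fin 3) ≃ₗᵢ[ℝ] EuclideanSpace ℝ (Fin 3)} (hρ : IsRotation ρ) :
    IsStationaryField (fun x => X (rotate ρ x)) P where
  measurable := hX.measurable.comp
    (((continuous_rotate ρ).measurable.comp measurable_fst).prodMk measurable_snd)
  memLp x := hX.memLp (rotate ρ x)
  stationary τ hτ x y := by
    simp only [hX.stationary ρ hρ, hX.stationary τ hτ]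

variable [SFinite P]

lemma memLp_prod (hX : IsStationaryField X P) :
    MemLp (fun z : S2 × Ω => X z.1 z.2) 2 (sphereMeasure.prod P) := by
  rw [memLp_two_iff_integrable_sq hX.measurable.aestronglyMeasurable,
    integrable_prod_iff (hX.measurable.pow_const 2).aestronglyMeasurable]
  have hconst (x : S2) : ∫ ω, ‖X x ω ^ 2‖ ∂P = ∫ ω, ‖X northPole ω ^ 2‖ ∂P :=
    eq_northPole_of_rotate_eq (fun x => ∫ ω, ‖X x ω ^ 2‖ ∂P)
      (fun ρ hρ x => by simpa [← sq] using hX.stationary ρ hρ x x) x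
  exact ⟨Eventually.of_forall fun x => (hX.memLp x).integrable_sq, by
    simp only [hconst]; exact integrable_const _⟩

lemma integral_sq_fieldIntegral_eq_northPole (hX : IsStationaryField X P) {K : ℝ → ℝ}
    (hK : Continuous K) (x : S2) :
    ∫ ω, fieldIntegral sphereMeasure X (fun y => K (dot x y)) ω ^ 2 ∂P =
      ∫ ω, fieldIntegral sphereMeasure X (fun y => K (dot northPole y)) ω ^ 2 ∂P := by
  refine eq_northPole_of_rotate_eq
    (fun x => ∫ ω, fieldIntegral sphereMeasure X (fun y => K (dot x y)) ω ^ 2 ∂P)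
    (fun ρ hρ x => ?_) x
  have hrotate (ω : Ω) : fieldIntegral sphereMeasure X (fun y => K (dot (rotate ρ x) y)) ω =
      fieldIntegral sphereMeasure (fun y => X (rotate ρ y)) (fun y => K (dot x y)) ω := by
    rw [fieldIntegral, ← integral_comp_rotate ρ]
    simp only [dot_rotate, fieldIntegral]
  simp only [hrotate]
  rw [integral_fieldIntegral_sq (hX.comp_rotate hρ).memLp_prod (by fun_prop),
    integral_fieldIntegral_sq hX.memLp_prod (by fun_prop), covIntegral, covIntegral,
    hX.fieldCov_rotate hρ]

lemma integral_covIntegral_zonal_mul_zonal (hX : IsStationaryField X P) (n : ℕ) (c : ℕ → ℝ) :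
    ∫ x, covIntegral sphereMeasure X P (fun z => zonal n c (dot x z.1) * zonal n c (dot x z.2))
        ∂sphereMeasure =
      covIntegral sphereMeasure X P (fun z => zonal n (fun ℓ => c ℓ * c ℓ) (dot z.1 z.2)) := by
  have hcov : Integrable (fieldCov X P) (sphereMeasure.prod sphereMeasure) := by
    simpa using integrable_fieldCov_mul hX.memLp_prod (continuous_const (y := (1 : ℝ)))
  have hInt : Integrable (fun w : S2 × (S2 × S2) => fieldCov X P w.2 *
      (zonal n c (dot w.1 w.2.1) * zonal n c (dot w.1 w.2.2)))
      (sphereMeasure.prod (sphereMeasure.prod sphereMeasure)) :=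
    integrable_mul_of_continuous (hcov.comp_snd sphereMeasure)
      (((continuous_zonal n c).comp
        (continuous_dot.comp (continuous_fst.prodMk continuous_snd.fst))).mul
        ((continuous_zonal n c).comp
          (continuous_dot.comp (continuous_fst.prodMk continuous_snd.snd))))
  simp only [covIntegral]
  rw [integral_integral_swap hInt]
  refine integral_congr_ae (Eventually.of_forall fun z => ?_)
  simp only [integral_const_mul, ← integral_zonal_mul_zonal]
  simp only [dot_comm z.1]

/-- The variance does not depend on the point, so it is an average over the sphere; averaging turns
the squared kernel into its convolution square. -/
theorem integral_sq_fieldIntegral_zonal [IsFiniteMeasure P] (hX : IsStationaryField X P) (n : ℕ)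
    (c : ℕ → ℝ) (x : S2) :
    ∫ ω, fieldIntegral sphereMeasure X (fun y => zonal n c (dot x y)) ω ^ 2 ∂P =
      (4 * Real.pi)⁻¹ *
        ∑ ℓ ∈ Finset.range n, (2 * (ℓ : ℝ) + 1) * c ℓ ^ 2 * powerSpectrum X P ℓ := by
  rw [eq_inv_mul_iff_mul_eq₀ (by positivity)]
  calc 4 * Real.pi * ∫ ω, fieldIntegral sphereMeasure X (fun y => zonal n c (dot x y)) ω ^ 2 ∂P
      = ∫ x, ∫ ω, fieldIntegral sphereMeasure X (fun y => zonal n c (dot x y)) ω ^ 2 ∂P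
          ∂sphereMeasure := by
        simp only [hX.integral_sq_fieldIntegral_eq_northPole (continuous_zonal n c)]
        rw [integral_const, sphereMeasure_real_univ, smul_eq_mul]
    _ = covIntegral sphereMeasure X P (fun z => zonal n (fun ℓ => c ℓ * c ℓ) (dot z.1 z.2)) := by
        rw [← hX.integral_covIntegral_zonal_mul_zonal]
        refine integral_congr_ae (Eventually.of_forall fun y => ?_)
        exact integral_fieldIntegral_sq hX.memLp_prod (by fun_prop)
    _ = ∑ ℓ ∈ Finset.range n, c ℓ * c ℓ * ((2 * (ℓ : ℝ) + 1) * powerSpectrum X P ℓ) := by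
        simp only [two_mul_add_one_mul_powerSpectrum hX.memLp_prod]
        exact covIntegral_sum hX.memLp_prod _ _ fun ℓ _ => by fun_prop
    _ = _ := Finset.sum_congr rfl fun ℓ _ => by ring

end IsStationaryField

end Stationary

/-! ### White noise -/

section WhiteNoise

variable {Ω ι : Type*} [MeasurableSpace Ω] {P : Measure Ω}

/-- An orthonormal family of square integrable variables, orthogonal to the field `X`: the
second-order content of an independent standard Gaussian noise. -/
structure IsWhiteNoise {T : Type*} (X : T → Ω → ℝ) (U : ι → Ω → ℝ) (P : Measure Ω) : Prop where
  memLp : ∀ i, MemLp (U i) 2 P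
  integral_sq : ∀ i, ∫ ω, U i ω ^ 2 ∂P = 1
  integral_mul : ∀ i i', i ≠ i' → ∫ ω, U i ω * U i' ω ∂P = 0
  integral_field_mul : ∀ x i, ∫ ω, X x ω * U i ω ∂P = 0

lemma integral_add_mul_sq {S V : Ω → ℝ} (hS : MemLp S 2 P) (hV : MemLp V 2 P)
    (hSV : ∫ ω, S ω * V ω ∂P = 0) (b : ℝ) :
    ∫ ω, (S ω + b * V ω) ^ 2 ∂P = ∫ ω, S ω ^ 2 ∂P + b ^ 2 * ∫ ω, V ω ^ 2 ∂P := by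
  have hexpand (ω : Ω) : (S ω + b * V ω) ^ 2 =
      S ω ^ 2 + 2 * b * (S ω * V ω) + b ^ 2 * V ω ^ 2 := by ring
  have hcross : Integrable (fun ω => 2 * b * (S ω * V ω)) P := (hS.integrable_mul hV).const_mul _
  simp only [hexpand]
  rw [integral_add (hS.integrable_sq.fun_add hcross) (hV.integrable_sq.const_mul _),
    integral_add hS.integrable_sq hcross, integral_const_mul, integral_const_mul, hSV, mul_zero,
    add_zero]

lemma integral_add_sum_sq {S : Ω → ℝ} {V : ι → Ω → ℝ} (hS : MemLp S 2 P)
    (hV : ∀ i, MemLp (V i) 2 P) (hSV : ∀ i, ∫ ω, S ω * V i ω ∂P = 0)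
    (hsq : ∀ i, ∫ ω, V i ω ^ 2 ∂P = 1) (hVV : ∀ i i', i ≠ i' → ∫ ω, V i ω * V i' ω ∂P = 0)
    (s : Finset ι) (b : ι → ℝ) :
    ∫ ω, (S ω + ∑ i ∈ s, b i * V i ω) ^ 2 ∂P = ∫ ω, S ω ^ 2 ∂P + ∑ i ∈ s, b i ^ 2 := by
  classical
  induction s using Finset.induction_on with
  | empty => simp
  | insert i s hi ih =>
    have hsum : MemLp (fun ω => ∑ i' ∈ s, b i' * V i' ω) 2 P :=
      memLp_finsetSum _ fun i' _ => (hV i').const_mul _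
    have horth : ∫ ω, (S ω + ∑ i' ∈ s, b i' * V i' ω) * V i ω ∂P = 0 := by
      have hInt (i' : ι) : Integrable (fun ω => b i' * (V i' ω * V i ω)) P :=
        ((hV i').integrable_mul (hV i)).const_mul _
      have hSV_int : Integrable (fun ω => S ω * V i ω) P := hS.integrable_mul (hV i)
      simp only [add_mul, Finset.sum_mul, mul_assoc]
      rw [integral_add hSV_int (integrable_finsetSum _ fun i' _ => hInt i'),
        integral_finsetSum _ fun i' _ => hInt i', hSV, zero_add]
      refine Finset.sum_eq_zero fun i' hi' => ?_
      rw [integral_const_mul, hVV i' i (ne_of_mem_of_not_mem hi' hi), mul_zero]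
    have hstep := integral_add_mul_sq (hS.add hsum) (hV i) horth (b i)
    simp only [Pi.add_apply] at hstep
    simp only [Finset.sum_insert hi, add_comm (b i * _), ← add_assoc, hstep, ih, hsq, mul_one]
    ring

end WhiteNoise

/-! ### Needlet coefficients of the observations -/

lemma bandSpectrum_eq_sum_range {B : ℝ} {a : ℝ → ℝ} {j n : ℕ}
    (h : ∀ ℓ, n ≤ ℓ → window B a j ℓ = 0) (C : ℕ → ℝ) :
    bandSpectrum B a C j = (4 * Real.pi)⁻¹ *
      ∑ ℓ ∈ Finset.range n, (2 * (ℓ : ℝ) + 1) * window B a j ℓ ^ 2 * C ℓ := by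
  rw [bandSpectrum, tsum_eq_sum fun ℓ hℓ => ?_]
  simp [h ℓ (not_lt.mp (Finset.mem_range.not.mp hℓ))]

namespace Design

variable {B : ℝ} {a : ℝ → ℝ} {c₀ κ : ℝ} (D : Design B a c₀ κ)

/-- The number of degrees in the passband of the low-pass filter. -/
def bandwidth (j : ℕ) : ℕ := 2 * D.L j + 1

lemma window_eq_zero_of_bandwidth_le {j ℓ : ℕ} (h : D.bandwidth j ≤ ℓ) : window B a j ℓ = 0 :=
  D.window_band j ℓ (by unfold bandwidth at h; omega)

lemma beam_eq_zero_of_bandwidth_le {j ℓ : ℕ} (h : D.bandwidth j ≤ ℓ) : D.beam j ℓ = 0 :=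
  D.beam_high j ℓ (by unfold bandwidth at h; omega)

lemma window_mul_beam (j ℓ : ℕ) : window B a j ℓ * D.beam j ℓ = window B a j ℓ := by
  rcases le_or_gt ℓ (D.L j) with h | h
  · rw [D.beam_low j ℓ h, mul_one]
  · rw [D.window_band j ℓ h, zero_mul]

lemma lam_pos (j : ℕ) (k : Fin (D.N j)) : 0 < D.lam j k := (D.pixelization j).weight_pos k

/-- The needlet kernel `∑_ℓ b_{j,ℓ} L_ℓ(ξ_{j,k} · ξ_{j,p})` between two pixels, that is
`ψ_{j,k}(ξ_{j,p})` without its factor `√λ_{j,k}`. -/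
def kernel (j : ℕ) (k p : Fin (D.N j)) : ℝ :=
  zonal (D.bandwidth j) (window B a j) (dot (D.ξ j k) (D.ξ j p))

lemma needlet_eq_sqrt_mul_kernel (j : ℕ) (k p : Fin (D.N j)) :
    D.needlet j k (D.ξ j p) = √(D.lam j k) * D.kernel j k p := by
  rw [needlet, kernel, zonal, dot_comm, tsum_eq_sum fun ℓ hℓ => ?_]
  rw [D.window_eq_zero_of_bandwidth_le (not_lt.mp (Finset.mem_range.not.mp hℓ)), zero_mul]

lemma needletCoeff_eq_sum_kernel (j : ℕ) (f : Fin (D.N j) → ℝ) (k : Fin (D.N j)) :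
    D.needletCoeff j f k = ∑ p, D.lam j p * D.kernel j k p * f p := by
  have hsqrt := Real.sqrt_pos.mpr (D.lam_pos j k)
  rw [needletCoeff, Finset.mul_sum]
  refine Finset.sum_congr rfl fun p _ => ?_
  rw [needlet_eq_sqrt_mul_kernel]
  field_simp

lemma noiseLevel_sq (j : ℕ) (k : Fin (D.N j)) : D.noiseLevel j k ^ 2 =
    ∑ p, (D.lam j p * D.kernel j k p * (D.W j p * D.σ j p)) ^ 2 := by
  have hlam := D.lam_pos j k
  rw [noiseLevel, Real.sq_sqrt (mul_nonneg (inv_nonneg.mpr hlam.le)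
    (Finset.sum_nonneg fun p _ => sq_nonneg _)), Finset.mul_sum]
  refine Finset.sum_congr rfl fun p _ => ?_
  simp only [needlet_eq_sqrt_mul_kernel, mul_pow, Real.sq_sqrt hlam.le]
  field_simp

/-- The low-passed field `X_j` as the convolution of `X` with a zonal kernel. -/
def signal {Ω : Type*} (X : S2 → Ω → ℝ) (j : ℕ) (x : S2) : Ω → ℝ :=
  fieldIntegral sphereMeasure X (fun y => zonal (D.bandwidth j) (D.beam j) (dot x y))

lemma lowPass_eq_signal {Ω : Type*} {X : S2 → Ω → ℝ} {ω : Ω}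
    (hω : Integrable (fun y => X y ω) sphereMeasure) (j : ℕ) (x : S2) :
    D.lowPass X j x ω = D.signal X j x ω := by
  have hdegree (ℓ : ℕ) : ∑ m ∈ Finset.Icc (-(ℓ : ℤ)) (ℓ : ℤ),
      (D.beam j ℓ : ℂ) * harmonicCoeff X ℓ m ω * sphericalHarmonic ℓ m x =
      (D.beam j ℓ * fieldIntegral sphereMeasure X (fun y => legendreL ℓ (dot x y)) ω : ℝ) := by
    simp only [mul_assoc, ← Finset.mul_sum, sum_harmonicCoeff_mul_sphericalHarmonic hω,
      Complex.ofReal_mul]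
  simp only [lowPass, hdegree]
  rw [tsum_eq_sum (s := Finset.range (D.bandwidth j)) fun ℓ hℓ => ?_, ← Complex.ofReal_sum,
    Complex.ofReal_re]
  · exact (fieldIntegral_sum hω _ _ fun ℓ _ => by fun_prop).symm
  · rw [D.beam_eq_zero_of_bandwidth_le (not_lt.mp (Finset.mem_range.not.mp hℓ)), zero_mul,
      Complex.ofReal_zero]

/-- The needlet coefficients of the noiseless low-passed field, multiplied at the pixels by
weights `v`. -/
def weightedCoeff {Ω : Type*} (X : S2 → Ω → ℝ) (j : ℕ) (v : Fin (D.N j) → ℝ) (k : Fin (D.N j))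
    (ω : Ω) : ℝ :=
  ∑ p, D.lam j p * D.kernel j k p * v p * D.signal X j (D.ξ j p) ω

lemma needletCoeff_obs_eq {Ω : Type*} {X : S2 → Ω → ℝ} {U : (Σ j : ℕ, Fin (D.N j)) → Ω → ℝ}
    {ω : Ω} (hω : Integrable (fun y => X y ω) sphereMeasure) (j : ℕ) (k : Fin (D.N j)) :
    D.needletCoeff j (fun p => D.obs X U j p ω) k =
      D.weightedCoeff X j (D.W j) k ω +
        ∑ p, D.lam j p * D.kernel j k p * (D.W j p * D.σ j p) * U ⟨j, p⟩ ω := by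
  rw [needletCoeff_eq_sum_kernel, weightedCoeff, ← Finset.sum_add_distrib]
  refine Finset.sum_congr rfl fun p _ => ?_
  rw [obs, D.lowPass_eq_signal hω]
  ring

variable {Ω : Type*} [MeasurableSpace Ω] {P : Measure Ω} {X : S2 → Ω → ℝ}
  {U : (Σ j : ℕ, Fin (D.N j)) → Ω → ℝ}

variable {D} in
lemma IsNoise.isWhiteNoise (hU : D.IsNoise X U P) (hX : ∀ x, AEStronglyMeasurable (X x) P) :
    IsWhiteNoise X U P := by
  have hmeas (i : Σ j : ℕ, Fin (D.N j)) : AEMeasurable (U i) P := (hU.measurable i).aemeasurable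
  have hmean (i : Σ j : ℕ, Fin (D.N j)) : ∫ ω, U i ω ∂P = 0 := by
    rw [← integral_map (f := fun x : ℝ => x) (hmeas i) measurable_id.aestronglyMeasurable,
      hU.law i, integral_id_gaussianReal]
  have hvariance (i : Σ j : ℕ, Fin (D.N j)) : Var[U i; P] = 1 := by
    have hmap := variance_map (X := fun x : ℝ => x) measurable_id.aemeasurable (hmeas i)
    rw [hU.law i, variance_fun_id_gaussianReal] at hmap
    exact_mod_cast hmap.symm
  refine ⟨fun i => ?_, fun i => ?_, fun i i' hne => ?_, fun x i => ?_⟩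
  · exact MemLp.comp_of_map (g := id) (by rw [hU.law i]; exact memLp_id_gaussianReal 2) (hmeas i)
  · rw [← variance_of_integral_eq_zero (hmeas i) (hmean i), hvariance]
  · rw [(hU.indep.indepFun hne).integral_fun_mul_eq_mul_integral (hmeas i).aestronglyMeasurable
      (hmeas i').aestronglyMeasurable, hmean, zero_mul]
  · have hindep : IndepFun (X x) (U i) P :=
      hU.indep_field.comp (measurable_pi_apply x) (measurable_pi_apply i)
    rw [hindep.integral_fun_mul_eq_mul_integral (hX x) (hmeas i).aestronglyMeasurable, hmean,
      mul_zero]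

section SFinite

variable [SFinite P]

lemma memLp_signal (hX : IsStationaryField X P) (j : ℕ) (x : S2) : MemLp (D.signal X j x) 2 P :=
  memLp_fieldIntegral hX.memLp_prod (by fun_prop)

lemma memLp_weightedCoeff (hX : IsStationaryField X P) (j : ℕ) (v : Fin (D.N j) → ℝ)
    (k : Fin (D.N j)) : MemLp (D.weightedCoeff X j v k) 2 P :=
  memLp_finsetSum _ fun p _ => (D.memLp_signal hX j (D.ξ j p)).const_mul _

lemma integral_weightedCoeff_mul_noise (hX : IsStationaryField X P) (hU : IsWhiteNoise X U P)
    (j : ℕ) (v : Fin (D.N j) → ℝ) (k : Fin (D.N j)) (i : Σ j : ℕ, Fin (D.N j)) :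
    ∫ ω, D.weightedCoeff X j v k ω * U i ω ∂P = 0 := by
  simp only [weightedCoeff, Finset.sum_mul, mul_assoc _ (D.signal X j _ _)]
  have hInt (p : Fin (D.N j)) : Integrable
      (fun ω => D.lam j p * D.kernel j k p * v p * (D.signal X j (D.ξ j p) ω * U i ω)) P :=
    ((D.memLp_signal hX j _).integrable_mul (hU.memLp i)).const_mul _
  rw [integral_finsetSum _ fun p _ => hInt p]
  refine Finset.sum_eq_zero fun p _ => ?_
  rw [integral_const_mul, signal, integral_fieldIntegral_mul_eq_zero hX.memLp_prod (by fun_prop)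
    (hU.memLp i) fun y => hU.integral_field_mul y i, mul_zero]

end SFinite

variable [IsFiniteMeasure P]

lemma integrable_needletCoeff_obs_sq (hX : IsStationaryField X P) (hU : IsWhiteNoise X U P)
    (j : ℕ) (k : Fin (D.N j)) :
    Integrable (fun ω => D.needletCoeff j (fun p => D.obs X U j p ω) k ^ 2) P := by
  refine MemLp.integrable_sq ((memLp_congr_ae ((ae_integrable_field hX.memLp_prod).mono
    fun ω hω => D.needletCoeff_obs_eq hω j k)).mpr ?_)
  exact (D.memLp_weightedCoeff hX j (D.W j) k).add
    (memLp_finsetSum _ fun p _ => (hU.memLp ⟨j, p⟩).const_mul _)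

lemma integral_needletCoeff_obs_sq (hX : IsStationaryField X P) (hU : IsWhiteNoise X U P)
    (j : ℕ) (k : Fin (D.N j)) :
    ∫ ω, D.needletCoeff j (fun p => D.obs X U j p ω) k ^ 2 ∂P =
      ∫ ω, D.weightedCoeff X j (D.W j) k ω ^ 2 ∂P + D.noiseLevel j k ^ 2 := by
  rw [integral_congr_ae ((ae_integrable_field hX.memLp_prod).mono
    fun ω hω => congrArg (· ^ 2) (D.needletCoeff_obs_eq hω j k)), noiseLevel_sq]
  exact integral_add_sum_sq (V := fun p => U ⟨j, p⟩) (D.memLp_weightedCoeff hX j _ k)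
    (fun p => hU.memLp _) (fun p => D.integral_weightedCoeff_mul_noise hX hU j _ k _)
    (fun p => hU.integral_sq _)
    (fun p p' hne => hU.integral_mul _ _ fun h => hne (eq_of_heq (Sigma.mk.inj h).2)) _ _

lemma integral_weightedCoeff_one_sq (hX : IsStationaryField X P) (j : ℕ) (k : Fin (D.N j)) :
    ∫ ω, D.weightedCoeff X j 1 k ω ^ 2 ∂P = bandSpectrum B a (powerSpectrum X P) j := by
  rw [bandSpectrum_eq_sum_range fun _ => D.window_eq_zero_of_bandwidth_le,
    ← hX.integral_sq_fieldIntegral_zonal _ _ (D.ξ j k)]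
  refine integral_congr_ae ((ae_integrable_field hX.memLp_prod).mono
    fun ω hω => congrArg (· ^ 2) ?_)
  have hcubature (y : S2) : zonal (D.bandwidth j) (window B a j) (dot (D.ξ j k) y) =
      ∑ p, D.lam j p * D.kernel j k p *
        zonal (D.bandwidth j) (D.beam j) (dot (D.ξ j p) y) := by
    have h := (D.pixelization j).sum_zonal_mul_zonal (n := 2 * D.L j) (by omega) (window B a j)
      (D.beam j) (D.ξ j k) y
    simp only [D.window_mul_beam, ← mul_assoc] at h
    exact h.symm
  simp only [hcubature]
  rw [fieldIntegral_sum hω _ _ fun p _ => by fun_prop]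
  simp [weightedCoeff, signal]

lemma integrable_estimator (hX : IsStationaryField X P) (hU : IsWhiteNoise X U P) (j : ℕ)
    (w : Fin (D.N j) → ℝ) : Integrable (D.estimator X U j w) P :=
  integrable_finsetSum _ fun k _ =>
    ((D.integrable_needletCoeff_obs_sq hX hU j k).sub (integrable_const _)).const_mul _

end Design

lemma Design.integral_estimator {B : ℝ} {a : ℝ → ℝ} {c₀ κ : ℝ} (D : Design B a c₀ κ) {Ω : Type*}
    [MeasurableSpace Ω] {P : Measure Ω} [IsProbabilityMeasure P] {X : S2 → Ω → ℝ}
    {U : (Σ j : ℕ, Fin (D.N j)) → Ω → ℝ} (hX : IsStationaryField X P) (hU : IsWhiteNoise X U P)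
    (j : ℕ) (w : Fin (D.N j) → ℝ) : ∫ ω, D.estimator X U j w ω ∂P =
      ∑ k, w k * ∫ ω, D.weightedCoeff X j (D.W j) k ω ^ 2 ∂P := by
  have hInt (k : Fin (D.N j)) := D.integrable_needletCoeff_obs_sq hX hU j k
  have hterm (k : Fin (D.N j)) : Integrable (fun ω => w k *
      (D.needletCoeff j (fun p => D.obs X U j p ω) k ^ 2 - D.noiseLevel j k ^ 2)) P :=
    ((hInt k).sub (integrable_const _)).const_mul _
  simp only [Design.estimator]
  rw [integral_finsetSum _ fun k _ => hterm k]
  refine Finset.sum_congr rfl fun k _ => ?_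
  rw [integral_const_mul, integral_sub (hInt k) (integrable_const _),
    D.integral_needletCoeff_obs_sq hX hU, integral_const, probReal_univ, one_smul,
    add_sub_cancel_right]

/-! ### Window functions and regular spectra -/

section Window

variable {B : ℝ} {M : ℕ} {a : ℝ → ℝ}

lemma window_zero (B : ℝ) (a : ℝ → ℝ) (j : ℕ) : window B a j 0 = 0 := by simp [window]

namespace IsWindowProfile

lemma continuous (ha : IsWindowProfile B M a) (hM : 0 < M) : Continuous a := by
  simpa only [iteratedDeriv_zero] using (ha.differentiable 0 hM).continuous

lemma eq_zero_of_lt (ha : IsWindowProfile B M a) {x : ℝ} (hx : B < x) : a x = 0 :=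
  Function.notMem_support.mp fun h => (ha.support h).2.not_gt hx

lemma apply_right_eq_zero (ha : IsWindowProfile B M a) (hM : 0 < M) : a B = 0 := by
  have hcont : Tendsto a (𝓝[>] B) (𝓝 (a B)) := (ha.continuous hM).continuousWithinAt.tendsto
  have hzero : Tendsto a (𝓝[>] B) (𝓝 0) := tendsto_const_nhds.congr' <| by
    filter_upwards [self_mem_nhdsWithin] with x hx using (ha.eq_zero_of_lt hx).symm
  exact tendsto_nhds_unique hcont hzero

lemma exists_window_eq_zero (ha : IsWindowProfile B M a) (hB : 1 < B) (j : ℕ) :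
    ∃ n, ∀ ℓ, n ≤ ℓ → window B a j ℓ = 0 := by
  refine ⟨⌊B * B * B ^ j⌋₊ + 1, fun ℓ hℓ => ?_⟩
  have hfine : B < (ℓ : ℝ) / B ^ j / B := by
    rw [lt_div_iff₀ (by positivity), lt_div_iff₀ (by positivity)]
    exact Nat.lt_of_floor_lt hℓ
  have hcoarse : B < (ℓ : ℝ) / B ^ j := hfine.trans_le (div_le_self (by positivity) hB.le)
  rw [window, ha.eq_zero_of_lt hfine, ha.eq_zero_of_lt hcoarse, sub_zero]

lemma exists_le_abs_of_mem_Icc (ha : IsWindowProfile B M a) (hB : 1 < B) (hM : 0 < M) :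
    ∃ u v η : ℝ, 0 < u ∧ u < v ∧ 0 < η ∧ ∀ x ∈ Set.Icc u v, η ≤ |a (x / B) - a x| := by
  have hB0 : 0 < B := one_pos.trans hB
  have hcont : Continuous fun x => |a (x / B) - a x| := by
    have := ha.continuous hM
    fun_prop
  obtain ⟨x₀, hx₀, hne⟩ : ∃ x₀ : ℝ, 0 < x₀ ∧ a (x₀ / B) - a x₀ ≠ 0 := by
    -- Otherwise `1 = a (1 / B) = a 1 = a (B / B) = a B = 0`.
    by_contra! hzero
    have hone : a (1 / B) = 1 := by
      rw [one_div]
      exact ha.eq_one _ ⟨by linarith [inv_pos.mpr hB0], le_rfl⟩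
    have hB_one : a 1 - a B = 0 := by simpa only [div_self hB0.ne'] using hzero B hB0
    linarith [hzero 1 one_pos, ha.apply_right_eq_zero hM]
  have hpos : 0 < |a (x₀ / B) - a x₀| := abs_pos.mpr hne
  obtain ⟨ε, hε, hball⟩ := Metric.eventually_nhds_iff.mp
    (hcont.continuousAt.eventually (lt_mem_nhds (half_lt_self hpos)))
  refine ⟨x₀, x₀ + ε / 2, _, hx₀, by linarith, half_pos hpos, fun x hx => (hball ?_).le⟩
  rw [Real.dist_eq, abs_of_nonneg (by linarith [hx.1])]
  linarith [hx.2]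

end IsWindowProfile

lemma sum_le_bandSpectrum {j n : ℕ} (h : ∀ ℓ, n ≤ ℓ → window B a j ℓ = 0) {C : ℕ → ℝ}
    (hC : ∀ ℓ, 0 ≤ C ℓ) (s : Finset ℕ) :
    (4 * Real.pi)⁻¹ * ∑ ℓ ∈ s, (2 * (ℓ : ℝ) + 1) * window B a j ℓ ^ 2 * C ℓ ≤
      bandSpectrum B a C j := by
  have hsum : Summable fun ℓ : ℕ => (2 * (ℓ : ℝ) + 1) * window B a j ℓ ^ 2 * C ℓ :=
    summable_of_ne_finset_zero (s := Finset.range n) fun ℓ hℓ => by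
      simp [h ℓ (not_lt.mp (Finset.mem_range.not.mp hℓ))]
  refine mul_le_mul_of_nonneg_left (hsum.sum_le_tsum s fun ℓ _ => ?_) (by positivity)
  exact mul_nonneg (by positivity) (hC ℓ)

lemma bandSpectrum_nonneg {C : ℕ → ℝ} (hC : ∀ ℓ, 0 ≤ C ℓ) (j : ℕ) :
    0 ≤ bandSpectrum B a C j :=
  mul_nonneg (by positivity) (tsum_nonneg fun ℓ => mul_nonneg (by positivity) (hC ℓ))

lemma bandSpectrum_one_nonneg (B : ℝ) (a : ℝ → ℝ) (j : ℕ) : 0 ≤ bandSpectrum B a 1 j :=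
  bandSpectrum_nonneg (fun _ => zero_le_one) j

lemma sub_sub_one_le_card_Icc_ceil_floor {x y : ℝ} (hx : 0 ≤ x) :
    y - x - 1 ≤ (Finset.Icc ⌈x⌉₊ ⌊y⌋₊).card := by
  have hceil := Nat.ceil_lt_add_one hx
  have hfloor := Nat.lt_floor_add_one y
  have hcard : ((⌊y⌋₊ + 1 : ℕ) : ℝ) ≤ ((⌊y⌋₊ + 1 - ⌈x⌉₊ : ℕ) : ℝ) + ⌈x⌉₊ := by
    exact_mod_cast le_tsub_add
  rw [Nat.card_Icc]
  push_cast at hcard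
  linarith

/-- On a fixed interval `[u, v]` the rescaled window is at least `η`, and `[u B^j, v B^j]` contains
about `(v - u) B^j` degrees `ℓ ≥ u B^j`. -/
lemma IsWindowProfile.eventually_mul_sq_le_bandSpectrum_one (ha : IsWindowProfile B M a)
    (hB : 1 < B) (hM : 0 < M) :
    ∃ δ > 0, ∀ᶠ j in atTop, δ * (B ^ j) ^ 2 ≤ bandSpectrum B a 1 j := by
  obtain ⟨u, v, η, hu, huv, hη, hwindow⟩ := ha.exists_le_abs_of_mem_Icc hB hM
  have huv' : 0 < v - u := sub_pos.mpr huv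
  refine ⟨(4 * Real.pi)⁻¹ * ((v - u) * u * η ^ 2), by positivity, ?_⟩
  filter_upwards [((tendsto_pow_atTop_atTop_of_one_lt hB).const_mul_atTop huv').eventually_ge_atTop
    2] with j hj
  obtain ⟨n, hn⟩ := ha.exists_window_eq_zero hB j
  have hR : 0 < B ^ j := by positivity
  set s := Finset.Icc ⌈u * B ^ j⌉₊ ⌊v * B ^ j⌋₊
  have hcard : (v - u) * B ^ j / 2 ≤ s.card := by
    linarith [sub_sub_one_le_card_Icc_ceil_floor (y := v * B ^ j) (mul_pos hu hR).le]
  have hterm (ℓ : ℕ) (hℓ : ℓ ∈ s) : 2 * u * B ^ j * η ^ 2 ≤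
      (2 * (ℓ : ℝ) + 1) * window B a j ℓ ^ 2 * (1 : ℕ → ℝ) ℓ := by
    have hlow : u * B ^ j ≤ ℓ := Nat.ceil_le.mp (Finset.mem_Icc.mp hℓ).1
    have hhigh : ℓ ≤ v * B ^ j :=
      (Nat.le_floor_iff (mul_pos (hu.trans huv) hR).le).mp (Finset.mem_Icc.mp hℓ).2
    have hη_le : η ^ 2 ≤ window B a j ℓ ^ 2 := sq_le_sq.mpr <| by
      rw [abs_of_pos hη]
      exact hwindow _ ⟨(le_div_iff₀ hR).mpr hlow, (div_le_iff₀ hR).mpr hhigh⟩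
    rw [Pi.one_apply, mul_one]
    exact mul_le_mul (by linarith) hη_le (by positivity) (by positivity)
  calc (4 * Real.pi)⁻¹ * ((v - u) * u * η ^ 2) * (B ^ j) ^ 2
      = (4 * Real.pi)⁻¹ * ((v - u) * B ^ j / 2 * (2 * u * B ^ j * η ^ 2)) := by ring
    _ ≤ (4 * Real.pi)⁻¹ * (s.card • (2 * u * B ^ j * η ^ 2)) := by
        rw [nsmul_eq_mul]
        gcongr
    _ ≤ _ := by
        gcongr
        exact s.card_nsmul_le_sum _ _ hterm
    _ ≤ bandSpectrum B a 1 j := sum_le_bandSpectrum hn (fun _ => zero_le_one) s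

/-- Only finitely many scales escape `eventually_mul_sq_le_bandSpectrum_one`; enlarging `K` covers
them unless the window vanishes there. -/
lemma IsWindowProfile.exists_sq_le_mul_bandSpectrum_one (ha : IsWindowProfile B M a)
    (hB : 1 < B) (hM : 0 < M) :
    ∃ K > 0, ∀ j, bandSpectrum B a 1 j ≠ 0 → (B ^ j) ^ 2 ≤ K * bandSpectrum B a 1 j := by
  obtain ⟨δ, hδ, hlower⟩ := ha.eventually_mul_sq_le_bandSpectrum_one hB hM
  have hbdd : IsBoundedUnder (· ≤ ·) atTop fun j => (B ^ j) ^ 2 / bandSpectrum B a 1 j := by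
    refine isBoundedUnder_of_eventually_le (a := δ⁻¹) (hlower.mono fun j hj => ?_)
    refine div_le_of_le_mul₀ (bandSpectrum_one_nonneg B a j) (by positivity) ?_
    rwa [inv_mul_eq_div, le_div_iff₀' hδ]
  obtain ⟨K, hK⟩ := hbdd.bddAbove_range
  refine ⟨max K 1, by positivity, fun j hj => ?_⟩
  have hpos := (bandSpectrum_one_nonneg B a j).lt_of_ne' hj
  exact (div_le_iff₀ hpos).mp ((hK (Set.mem_range_self j)).trans (le_max_left K 1))

lemma IsWindowProfile.exists_pow_mul_sqrt_bandSpectrum_one_le (ha : IsWindowProfile B M a)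
    (hB : 1 < B) (hM : 0 < M) :
    ∃ K > 0, ∀ j, B ^ j * √(bandSpectrum B a 1 j) ≤ K * bandSpectrum B a 1 j := by
  obtain ⟨K, hK, hscale⟩ := ha.exists_sq_le_mul_bandSpectrum_one hB hM
  refine ⟨√K, Real.sqrt_pos.mpr hK, fun j => ?_⟩
  set S := bandSpectrum B a 1 j
  rcases eq_or_ne S 0 with hS | hS
  · simp [hS]
  calc B ^ j * √S ≤ √(K * S) * √S := by
        gcongr
        exact Real.le_sqrt_of_sq_le (hscale j hS)
    _ = √K * S := by
        rw [Real.sqrt_mul hK.le, mul_assoc, Real.mul_self_sqrt (bandSpectrum_one_nonneg B a j)]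

lemma bandSpectrum_one_le_mul_bandSpectrum {j n : ℕ} (h : ∀ ℓ, n < ℓ → window B a j ℓ = 0)
    {c α : ℝ} (hc : 0 < c) (hα : 0 ≤ α) {C : ℕ → ℝ}
    (hC : ∀ ℓ : ℕ, 1 ≤ ℓ → c⁻¹ * (ℓ : ℝ) ^ (-α) ≤ C ℓ) :
    bandSpectrum B a 1 j ≤ c * (n : ℝ) ^ α * bandSpectrum B a C j := by
  rw [bandSpectrum_eq_sum_range (n := n + 1) h, bandSpectrum_eq_sum_range (n := n + 1) h,
    mul_left_comm, Finset.mul_sum _ _ (c * _)]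
  refine mul_le_mul_of_nonneg_left (Finset.sum_le_sum fun ℓ hℓ => ?_) (by positivity)
  rcases Nat.eq_zero_or_pos ℓ with rfl | hpos
  · simp [window_zero]
  have hℓ_pos : (0 : ℝ) < ℓ := by exact_mod_cast hpos
  have hℓ_le : (ℓ : ℝ) ≤ n := by exact_mod_cast Finset.mem_range_succ_iff.mp hℓ
  have hone : 1 ≤ c * (n : ℝ) ^ α * C ℓ := calc
    1 = c * (ℓ : ℝ) ^ α * (c⁻¹ * (ℓ : ℝ) ^ (-α)) := by
        rw [Real.rpow_neg hℓ_pos.le]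
        have := (Real.rpow_pos_of_pos hℓ_pos α).ne'
        field_simp
    _ ≤ c * (n : ℝ) ^ α * C ℓ := by
        gcongr
        exact hC ℓ hpos
  rw [Pi.one_apply, mul_left_comm]
  exact mul_le_mul_of_nonneg_left hone (by positivity)

end Window

namespace IsRegularSpectrum

variable {B : ℝ} {M : ℕ} {α : ℝ} {C : ℕ → ℝ}

lemma exists_two_sided_bound (hC : IsRegularSpectrum B M α C) (hB : 1 < B) :
    ∃ c > 0, ∀ ℓ : ℕ, 1 ≤ ℓ → c⁻¹ * (ℓ : ℝ) ^ (-α) ≤ C ℓ ∧ C ℓ ≤ c * (ℓ : ℝ) ^ (-α) := by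
  obtain ⟨g, c, hc, hCg, hg, -, -⟩ := hC
  refine ⟨c 0, hc 0 (Nat.zero_le M), fun ℓ hℓ => ?_⟩
  obtain ⟨j, hj_le, hj_lt⟩ := exists_nat_pow_near (y := B) (Nat.one_le_cast.mpr hℓ) hB
  have hBj : 0 < B ^ j := by positivity
  have hlow : B ^ ((j : ℤ) - 1) ≤ (ℓ : ℝ) := by
    refine le_trans ?_ hj_le
    rw [← zpow_natCast]
    exact zpow_le_zpow_right₀ hB.le (by omega)
  have hmem : (ℓ : ℝ) / B ^ j ∈ Set.Icc B⁻¹ B := by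
    refine ⟨(inv_le_one_of_one_le₀ hB.le).trans ((one_le_div hBj).mpr hj_le), ?_⟩
    rw [div_le_iff₀ hBj, ← pow_succ']
    exact hj_lt.le
  rw [hCg j ℓ hlow hj_lt.le, mul_comm _ (g j _)]
  exact ⟨by gcongr; exact (hg j _ hmem).1, by gcongr; exact (hg j _ hmem).2⟩

lemma summable (hC : IsRegularSpectrum B M α C) (hB : 1 < B) (hα : 2 < α) (hC0 : ∀ ℓ, 0 ≤ C ℓ) :
    Summable fun ℓ : ℕ => (2 * (ℓ : ℝ) + 1) * C ℓ := by
  obtain ⟨c, _, hbound⟩ := hC.exists_two_sided_bound hB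
  have hpower : Summable fun ℓ : ℕ => 3 * c * (ℓ : ℝ) ^ (1 - α) :=
    (Real.summable_nat_rpow.mpr (by linarith)).mul_left _
  rw [← summable_nat_add_iff 1] at hpower ⊢
  refine hpower.of_nonneg_of_le (fun ℓ => mul_nonneg (by positivity) (hC0 _)) fun ℓ => ?_
  have hone : (1 : ℝ) ≤ (ℓ + 1 : ℕ) := Nat.one_le_cast.mpr (Nat.le_add_left 1 ℓ)
  calc (2 * ((ℓ + 1 : ℕ) : ℝ) + 1) * C (ℓ + 1)
      ≤ (3 * ((ℓ + 1 : ℕ) : ℝ)) * (c * ((ℓ + 1 : ℕ) : ℝ) ^ (-α)) :=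
        mul_le_mul (by linarith) (hbound (ℓ + 1) (Nat.le_add_left 1 ℓ)).2 (hC0 _) (by positivity)
    _ = 3 * c * ((ℓ + 1 : ℕ) : ℝ) ^ (1 - α) := by
        rw [sub_eq_add_neg, Real.rpow_add (one_pos.trans_le hone), Real.rpow_one]
        ring

end IsRegularSpectrum

/-! ### The bias due to the mask -/

lemma abs_sum_mul_mul_le_sqrt_mul_sqrt {ι : Type*} (s : Finset ι) {lam : ι → ℝ}
    (hlam : ∀ i, 0 ≤ lam i) (x y : ι → ℝ) :
    |∑ i ∈ s, lam i * x i * y i| ≤ √(∑ i ∈ s, lam i * x i ^ 2) * √(∑ i ∈ s, lam i * y i ^ 2) := by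
  have hnonneg (z : ι → ℝ) (i : ι) : 0 ≤ lam i * z i ^ 2 := mul_nonneg (hlam i) (sq_nonneg _)
  rw [← Real.sqrt_mul (Finset.sum_nonneg fun i _ => hnonneg x i)]
  exact Real.abs_le_sqrt (Finset.sum_sq_le_sum_mul_sum_of_sq_le_mul s (fun i _ => hnonneg x i)
    (fun i _ => hnonneg y i) fun i _ => le_of_eq (by ring))

lemma abs_sum_mul_sub_le_mul {ι : Type*} [Fintype ι] {w x : ι → ℝ} {s : Set ι} {y A b : ℝ}
    (hw : ∑ i, w i = 1) (hwA : ∑ i, |w i| ≤ A) (hws : ∀ i, i ∉ s → w i = 0) (hb : 0 ≤ b)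
    (hx : ∀ i ∈ s, |x i - y| ≤ b) : |∑ i, w i * x i - y| ≤ A * b := by
  have hcentre : ∑ i, w i * x i - y = ∑ i, w i * (x i - y) := by
    simp only [mul_sub, Finset.sum_sub_distrib, ← Finset.sum_mul, hw, one_mul]
  have hterm (i : ι) : |w i * (x i - y)| ≤ |w i| * b := by
    rw [abs_mul]
    by_cases hi : i ∈ s
    · exact mul_le_mul_of_nonneg_left (hx i hi) (abs_nonneg _)
    · simp [hws i hi]
  calc |∑ i, w i * x i - y|
      ≤ ∑ i, |w i| * b := by
        rw [hcentre]
        exact (Finset.abs_sum_le_sum_abs _ _).trans (Finset.sum_le_sum fun i _ => hterm i)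
    _ ≤ A * b := by
        rw [← Finset.sum_mul]
        exact mul_le_mul_of_nonneg_right hwA hb

namespace Design

variable {B : ℝ} {a : ℝ → ℝ} {c₀ κ : ℝ} (D : Design B a c₀ κ)

lemma sum_lam_mul_kernel_sq (j : ℕ) (k : Fin (D.N j)) :
    ∑ p, D.lam j p * D.kernel j k p ^ 2 = bandSpectrum B a 1 j := by
  have hcubature := (D.pixelization j).sum_zonal_mul_zonal (n := 2 * D.L j) (by omega)
    (window B a j) (window B a j) (D.ξ j k) (D.ξ j k)
  rw [dot_self] at hcubature
  rw [bandSpectrum_eq_sum_range fun _ => D.window_eq_zero_of_bandwidth_le, Finset.mul_sum]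
  calc ∑ p, D.lam j p * D.kernel j k p ^ 2
      = zonal (D.bandwidth j) (fun ℓ => window B a j ℓ * window B a j ℓ) 1 := by
        rw [bandwidth, ← hcubature]
        refine Finset.sum_congr rfl fun p _ => ?_
        rw [dot_comm (D.ξ j p), kernel, bandwidth]
        ring
    _ = _ := Finset.sum_congr rfl fun ℓ _ => by
        rw [legendreL_one, Pi.one_apply]
        ring

/-- The energy of the low-passed field on the pixels. -/
def pixelEnergy {Ω : Type*} (X : S2 → Ω → ℝ) (j : ℕ) (ω : Ω) : ℝ :=
  ∑ p, D.lam j p * D.signal X j (D.ξ j p) ω ^ 2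

section Pointwise

variable {Ω : Type*} (X : S2 → Ω → ℝ) (j : ℕ)

lemma pixelEnergy_nonneg (ω : Ω) : 0 ≤ D.pixelEnergy X j ω :=
  Finset.sum_nonneg fun p _ => mul_nonneg (D.lam_pos j p).le (sq_nonneg _)

lemma abs_weightedCoeff_le (v : Fin (D.N j) → ℝ) (k : Fin (D.N j)) (ω : Ω) :
    |D.weightedCoeff X j v k ω| ≤
      √(∑ p, D.lam j p * (D.kernel j k p * v p) ^ 2) * √(D.pixelEnergy X j ω) := by
  simpa only [weightedCoeff, pixelEnergy, mul_assoc] using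
    abs_sum_mul_mul_le_sqrt_mul_sqrt Finset.univ (fun p => (D.lam_pos j p).le)
      (fun p => D.kernel j k p * v p) (fun p => D.signal X j (D.ξ j p) ω)

lemma abs_weightedCoeff_one_sub_le {t : ℝ} {k : Fin (D.N j)} (hk : k ∈ D.kept j t) (ω : Ω) :
    |D.weightedCoeff X j (1 - D.W j) k ω| ≤ t * (√(D.lam j k))⁻¹ * √(D.pixelEnergy X j ω) := by
  refine (D.abs_weightedCoeff_le X j _ k ω).trans ?_
  gcongr
  rw [← div_eq_mul_inv, le_div_iff₀ (Real.sqrt_pos.mpr (D.lam_pos j k)),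
    ← Real.sqrt_mul' _ (D.lam_pos j k).le, Finset.sum_mul]
  refine le_of_eq_of_le (congrArg Real.sqrt (Finset.sum_congr rfl fun p _ => ?_)) hk
  rw [needlet_eq_sqrt_mul_kernel, mul_pow √(D.lam j k), Real.sq_sqrt (D.lam_pos j k).le,
    Pi.sub_apply, Pi.one_apply]
  ring

lemma abs_weightedCoeff_one_add_le (k : Fin (D.N j)) (ω : Ω) :
    |D.weightedCoeff X j (1 + D.W j) k ω| ≤
      2 * √(bandSpectrum B a 1 j) * √(D.pixelEnergy X j ω) := by
  refine (D.abs_weightedCoeff_le X j _ k ω).trans ?_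
  gcongr
  refine Real.sqrt_le_iff.mpr ⟨by positivity, ?_⟩
  rw [mul_pow, Real.sq_sqrt (bandSpectrum_one_nonneg B a j),
    ← D.sum_lam_mul_kernel_sq j k, Finset.mul_sum]
  refine Finset.sum_le_sum fun p _ => ?_
  have hsq : (1 + D.W j p) ^ 2 ≤ 2 ^ 2 :=
    pow_le_pow_left₀ (by linarith [(D.W_mem j p).1]) (by linarith [(D.W_mem j p).2]) 2
  calc D.lam j p * (D.kernel j k p * (1 + D.W j) p) ^ 2
      = (1 + D.W j p) ^ 2 * (D.lam j p * D.kernel j k p ^ 2) := by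
        rw [Pi.add_apply, Pi.one_apply]
        ring
    _ ≤ 2 ^ 2 * (D.lam j p * D.kernel j k p ^ 2) :=
        mul_le_mul_of_nonneg_right hsq (mul_nonneg (D.lam_pos j p).le (sq_nonneg _))

lemma weightedCoeff_sq_sub_sq (u v : Fin (D.N j) → ℝ) (k : Fin (D.N j)) (ω : Ω) :
    D.weightedCoeff X j u k ω ^ 2 - D.weightedCoeff X j v k ω ^ 2 =
      D.weightedCoeff X j (u - v) k ω * D.weightedCoeff X j (u + v) k ω := by
  simp only [weightedCoeff, Pi.sub_apply, Pi.add_apply, mul_sub, mul_add, sub_mul, add_mul,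
    Finset.sum_sub_distrib, Finset.sum_add_distrib]
  ring

lemma abs_weightedCoeff_mask_sq_sub_le {t : ℝ} {k : Fin (D.N j)} (hk : k ∈ D.kept j t) (ω : Ω) :
    |D.weightedCoeff X j (D.W j) k ω ^ 2 - D.weightedCoeff X j 1 k ω ^ 2| ≤
      2 * t * ((√(D.lam j k))⁻¹ * √(bandSpectrum B a 1 j)) * D.pixelEnergy X j ω := by
  rw [abs_sub_comm, weightedCoeff_sq_sub_sq, abs_mul]
  have hsub := D.abs_weightedCoeff_one_sub_le X j hk ω
  calc |D.weightedCoeff X j (1 - D.W j) k ω| * |D.weightedCoeff X j (1 + D.W j) k ω|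
      ≤ t * (√(D.lam j k))⁻¹ * √(D.pixelEnergy X j ω) *
          (2 * √(bandSpectrum B a 1 j) * √(D.pixelEnergy X j ω)) :=
        mul_le_mul hsub (D.abs_weightedCoeff_one_add_le X j k ω) (abs_nonneg _)
          ((abs_nonneg _).trans hsub)
    _ = 2 * t * ((√(D.lam j k))⁻¹ * √(bandSpectrum B a 1 j)) *
          (√(D.pixelEnergy X j ω) * √(D.pixelEnergy X j ω)) := by ring
    _ = _ := by rw [Real.mul_self_sqrt (D.pixelEnergy_nonneg X j ω)]

end Pointwise

variable {Ω : Type*} [MeasurableSpace Ω] {P : Measure Ω} [IsFiniteMeasure P] {X : S2 → Ω → ℝ}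

lemma integrable_pixelEnergy (hX : IsStationaryField X P) (j : ℕ) :
    Integrable (D.pixelEnergy X j) P :=
  integrable_finsetSum _ fun _ _ => (D.memLp_signal hX j _).integrable_sq.const_mul _

lemma integral_pixelEnergy (hX : IsStationaryField X P) (j : ℕ) :
    ∫ ω, D.pixelEnergy X j ω ∂P = ∑ ℓ ∈ Finset.range (D.bandwidth j),
      (2 * (ℓ : ℝ) + 1) * D.beam j ℓ ^ 2 * powerSpectrum X P ℓ := by
  simp only [pixelEnergy]
  rw [integral_finsetSum _ fun p _ => (D.memLp_signal hX j (D.ξ j p)).integrable_sq.const_mul _]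
  simp only [integral_const_mul, signal, hX.integral_sq_fieldIntegral_zonal]
  rw [← Finset.sum_mul, (D.pixelization j).sum_weight, mul_inv_cancel_left₀ (by positivity)]

lemma integral_pixelEnergy_le (hX : IsStationaryField X P) {β : ℝ}
    (hβ : ∀ j ℓ, |D.beam j ℓ| ≤ β)
    (hsum : Summable fun ℓ : ℕ => (2 * (ℓ : ℝ) + 1) * powerSpectrum X P ℓ) (j : ℕ) :
    ∫ ω, D.pixelEnergy X j ω ∂P ≤
      β ^ 2 * ∑' ℓ : ℕ, (2 * (ℓ : ℝ) + 1) * powerSpectrum X P ℓ := by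
  have hnonneg (ℓ : ℕ) : 0 ≤ (2 * (ℓ : ℝ) + 1) * powerSpectrum X P ℓ :=
    mul_nonneg (by positivity) (powerSpectrum_nonneg X P ℓ)
  calc ∫ ω, D.pixelEnergy X j ω ∂P
      = ∑ ℓ ∈ Finset.range (D.bandwidth j),
          D.beam j ℓ ^ 2 * ((2 * (ℓ : ℝ) + 1) * powerSpectrum X P ℓ) := by
        rw [D.integral_pixelEnergy hX]
        exact Finset.sum_congr rfl fun ℓ _ => by ring
    _ ≤ ∑ ℓ ∈ Finset.range (D.bandwidth j),
          β ^ 2 * ((2 * (ℓ : ℝ) + 1) * powerSpectrum X P ℓ) :=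
        Finset.sum_le_sum fun ℓ _ =>
          mul_le_mul_of_nonneg_right (sq_le_sq.mpr ((hβ j ℓ).trans (le_abs_self β))) (hnonneg ℓ)
    _ ≤ _ := by
        rw [← Finset.mul_sum]
        exact mul_le_mul_of_nonneg_left (hsum.sum_le_tsum _ fun ℓ _ => hnonneg ℓ) (sq_nonneg β)

lemma abs_integral_weightedCoeff_mask_sq_sub_le (hX : IsStationaryField X P) (j : ℕ) {t : ℝ}
    {k : Fin (D.N j)} (hk : k ∈ D.kept j t) :
    |∫ ω, D.weightedCoeff X j (D.W j) k ω ^ 2 ∂P - bandSpectrum B a (powerSpectrum X P) j| ≤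
      2 * t * ((√(D.lam j k))⁻¹ * √(bandSpectrum B a 1 j)) * ∫ ω, D.pixelEnergy X j ω ∂P := by
  rw [← D.integral_weightedCoeff_one_sq hX j k,
    ← integral_sub (D.memLp_weightedCoeff hX j _ k).integrable_sq
      (D.memLp_weightedCoeff hX j _ k).integrable_sq, ← integral_const_mul]
  refine abs_integral_le_integral_abs.trans ?_
  exact integral_mono_of_nonneg (Eventually.of_forall fun ω => abs_nonneg _)
    ((D.integrable_pixelEnergy hX j).const_mul _)
    (Eventually.of_forall fun ω => D.abs_weightedCoeff_mask_sq_sub_le X j hk ω)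

lemma inv_sqrt_lam_le (hc₀ : 0 < c₀) (j : ℕ) (k : Fin (D.N j)) :
    (√(D.lam j k))⁻¹ ≤ √c₀ * (4 * D.L j) := by
  have hL : (0 : ℝ) < D.L j := by exact_mod_cast D.L_pos j
  have hlower : (√c₀ * (4 * D.L j))⁻¹ ≤ √(D.lam j k) := by
    refine Real.le_sqrt_of_sq_le ?_
    rw [inv_pow, mul_pow, Real.sq_sqrt hc₀.le, mul_inv]
    exact_mod_cast (D.pixelization j).weight_lower k
  exact inv_le_of_inv_le₀ (by positivity) hlower

lemma kappa_pos (D : Design B a c₀ κ) : 0 < κ := by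
  have hL : (0 : ℝ) < D.L 0 := by exact_mod_cast D.L_pos 0
  simpa using hL.trans_le (D.L_le 0)

lemma exists_inv_sqrt_lam_mul_sqrt_le {M : ℕ} {α : ℝ} {C : ℕ → ℝ} (hB : 1 < B) (hM : 0 < M)
    (ha : IsWindowProfile B M a) (hα : 0 ≤ α) (hC : IsRegularSpectrum B M α C)
    (hC0 : ∀ ℓ, 0 ≤ C ℓ) (hc₀ : 0 < c₀) :
    ∃ K > 0, ∀ j k, (√(D.lam j k))⁻¹ * √(bandSpectrum B a 1 j) ≤
      K * B ^ (α * (j : ℝ)) * bandSpectrum B a C j := by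
  obtain ⟨c, hc, hlower⟩ := hC.exists_two_sided_bound hB
  obtain ⟨K, hK, hroot⟩ := ha.exists_pow_mul_sqrt_bandSpectrum_one_le hB hM
  have hκ := D.kappa_pos
  have hpow (j : ℕ) : (κ * B ^ j) ^ α = κ ^ α * B ^ (α * (j : ℝ)) := by
    rw [Real.mul_rpow hκ.le (by positivity), mul_comm α, Real.rpow_natCast_mul (by positivity)]
  refine ⟨√c₀ * 4 * κ * K * c * κ ^ α, by positivity, fun j k => ?_⟩
  set S := bandSpectrum B a 1 j
  have hS_le : S ≤ c * (κ ^ α * B ^ (α * (j : ℝ))) * bandSpectrum B a C j := by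
    refine (bandSpectrum_one_le_mul_bandSpectrum (D.window_band j) hc hα
      fun ℓ hℓ => (hlower ℓ hℓ).1).trans ?_
    rw [← hpow]
    have := bandSpectrum_nonneg (B := B) (a := a) hC0 j
    gcongr
    exact D.L_le j
  calc (√(D.lam j k))⁻¹ * √S
      ≤ √c₀ * (4 * (κ * B ^ j)) * √S := by
        gcongr
        exact (D.inv_sqrt_lam_le hc₀ j k).trans (by gcongr; exact D.L_le j)
    _ = √c₀ * 4 * κ * (B ^ j * √S) := by ring
    _ ≤ √c₀ * 4 * κ * (K * (c * (κ ^ α * B ^ (α * (j : ℝ))) * bandSpectrum B a C j)) := by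
        gcongr √c₀ * 4 * κ * ?_
        exact (hroot j).trans (by gcongr)
    _ = √c₀ * 4 * κ * K * c * κ ^ α * B ^ (α * (j : ℝ)) * bandSpectrum B a C j := by ring

end Design

section Estimator

variable {B : ℝ} {a : ℝ → ℝ} {c₀ κ : ℝ} {D : Design B a c₀ κ} {Ω : Type*} [MeasurableSpace Ω]
  {P : Measure Ω} [IsProbabilityMeasure P] {X : S2 → Ω → ℝ} {U : (Σ j : ℕ, Fin (D.N j)) → Ω → ℝ}

theorem integral_estimator_of_mask_eq_one (hX : IsStationaryField X P)
    (hU : IsWhiteNoise X U P) {j : ℕ} (hW : ∀ k, D.W j k = 1) {w : Fin (D.N j) → ℝ}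
    (hw : ∑ k, w k = 1) :
    ∫ ω, D.estimator X U j w ω ∂P = bandSpectrum B a (powerSpectrum X P) j := by
  have hmask : D.W j = 1 := funext hW
  simp only [D.integral_estimator hX hU, hmask, D.integral_weightedCoeff_one_sq hX,
    ← Finset.sum_mul, hw, one_mul]

theorem exists_abs_integral_estimator_sub_le {M : ℕ} {α : ℝ} (hX : IsStationaryField X P)
    (hU : IsWhiteNoise X U P) (hB : 1 < B) (hM : 0 < M) (ha : IsWindowProfile B M a)
    (hα : 2 < α) (hC : IsRegularSpectrum B M α (powerSpectrum X P)) (hc₀ : 0 < c₀) {β : ℝ}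
    (hβ : ∀ j ℓ, |D.beam j ℓ| ≤ β) (A : ℝ) :
    ∃ c : ℝ, 0 < c ∧ ∀ (t : ℝ) (j : ℕ) (w : Fin (D.N j) → ℝ), ∑ k, w k = 1 → ∑ k, |w k| ≤ A →
      (∀ k, k ∉ D.kept j t → w k = 0) →
      |∫ ω, D.estimator X U j w ω ∂P - bandSpectrum B a (powerSpectrum X P) j| ≤
        c * B ^ (α * (j : ℝ)) * t * bandSpectrum B a (powerSpectrum X P) j := by
  have hC0 := powerSpectrum_nonneg X P
  obtain ⟨K, hK, hnorm⟩ :=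
    D.exists_inv_sqrt_lam_mul_sqrt_le hB hM ha (by linarith) hC hC0 hc₀
  set E := β ^ 2 * ∑' ℓ : ℕ, (2 * (ℓ : ℝ) + 1) * powerSpectrum X P ℓ
  have hE (j : ℕ) : ∫ ω, D.pixelEnergy X j ω ∂P ≤ max E 1 :=
    (D.integral_pixelEnergy_le hX hβ (hC.summable hB hα hC0) j).trans (le_max_left E 1)
  refine ⟨max A 1 * (2 * K * max E 1), by positivity, fun t j w hw hwA hkept => ?_⟩
  have hCj : 0 ≤ bandSpectrum B a (powerSpectrum X P) j := bandSpectrum_nonneg hC0 j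
  obtain ⟨k₀, -, hk₀⟩ : ∃ k ∈ Finset.univ, w k ≠ 0 :=
    Finset.exists_ne_zero_of_sum_ne_zero (hw ▸ one_ne_zero)
  have ht : 0 ≤ t := (Real.sqrt_nonneg _).trans (of_not_not fun h => hk₀ (hkept k₀ h))
  have hpixel (k : Fin (D.N j)) (hk : k ∈ D.kept j t) :
      |∫ ω, D.weightedCoeff X j (D.W j) k ω ^ 2 ∂P - bandSpectrum B a (powerSpectrum X P) j| ≤
        2 * t * (K * B ^ (α * (j : ℝ)) * bandSpectrum B a (powerSpectrum X P) j) * max E 1 := by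
    refine (D.abs_integral_weightedCoeff_mask_sq_sub_le hX j hk).trans ?_
    gcongr 2 * t * ?_ * ?_
    · exact integral_nonneg fun ω => D.pixelEnergy_nonneg X j ω
    · exact hnorm j k
    · exact hE j
  rw [D.integral_estimator hX hU]
  refine (abs_sum_mul_sub_le_mul hw (hwA.trans (le_max_left A 1)) hkept (by positivity)
    hpixel).trans_eq ?_
  ring

end Estimator

end Needlet

end

theorem proposition7_general {Ω : Type*} [MeasurableSpace Ω] (P : Measure Ω)
    [IsProbabilityMeasure P] (X : Needlet.S2 → Ω → ℝ) (hX : Needlet.IsStationaryField X P)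
    (B : ℝ) (hB : 1 < B) (M : ℕ) (hM : 0 < M)
    (a : ℝ → ℝ) (ha : Needlet.IsWindowProfile B M a)
    (α : ℝ) (hα : 2 < α)
    (hC : Needlet.IsRegularSpectrum B M α (Needlet.powerSpectrum X P))
    (c₀ κ : ℝ) (hc₀ : 0 < c₀) (D : Needlet.Design B a c₀ κ)
    (U : (Σ j : ℕ, Fin (D.N j)) → Ω → ℝ) (hU : Needlet.IsWhiteNoise X U P) :
    (∀ β A : ℝ, (∀ j ℓ, |D.beam j ℓ| ≤ β) →
      ∃ c : ℝ, 0 < c ∧ ∀ (t : ℕ → ℝ) (w : ∀ j, Fin (D.N j) → ℝ) (j : ℕ),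
        ∑ k, w j k = 1 → ∑ k, |w j k| ≤ A → (∀ k, k ∉ D.kept j (t j) → w j k = 0) →
        Integrable (D.estimator X U j (w j)) P ∧
        |∫ ω, D.estimator X U j (w j) ω ∂P -
            Needlet.bandSpectrum B a (Needlet.powerSpectrum X P) j| ≤
          c * B ^ (α * (j : ℝ)) * t j *
            Needlet.bandSpectrum B a (Needlet.powerSpectrum X P) j) ∧
    (∀ j : ℕ, (∀ k, D.W j k = 1) → ∀ w : Fin (D.N j) → ℝ, ∑ k, w k = 1 →
      Integrable (D.estimator X U j w) P ∧
      ∫ ω, D.estimator X U j w ω ∂P =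
        Needlet.bandSpectrum B a (Needlet.powerSpectrum X P) j) := by
  refine ⟨fun β A hβ => ?_, fun j hW w hw => ⟨D.integrable_estimator hX hU j w,
    Needlet.integral_estimator_of_mask_eq_one hX hU hW hw⟩⟩
  obtain ⟨c, hc, hbias⟩ :=
    Needlet.exists_abs_integral_estimator_sub_le hX hU hB hM ha hα hC hc₀ hβ A
  exact ⟨c, hc, fun t w j hw hwA hkept =>
    ⟨D.integrable_estimator hX hU j (w j), hbias (t j) j (w j) hw hwA hkept⟩⟩

theorem proposition7 {Ω : Type*} [MeasurableSpace Ω] (P : Measure Ω) [IsProbabilityMeasure P]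
    (X : Needlet.S2 → Ω → ℝ) (hX : Needlet.IsStationaryGaussianField X P)
    (B : ℝ) (hB : 1 < B) (M : ℕ) (hM : 3 ≤ M)
    (a : ℝ → ℝ) (ha : Needlet.IsWindowProfile B M a)
    (α : ℝ) (hα : 2 < α)
    (hC : Needlet.IsRegularSpectrum B M α (Needlet.powerSpectrum X P))
    (c₀ κ : ℝ) (hc₀ : 0 < c₀) (D : Needlet.Design B a c₀ κ)
    (U : (Σ j : ℕ, Fin (D.N j)) → Ω → ℝ) (hU : D.IsNoise X U P) :
    -- bias bound, for a uniformly bounded low-pass filter and weights bounded in `ℓ¹`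
    (∀ β A : ℝ, (∀ j ℓ, |D.beam j ℓ| ≤ β) →
      ∃ c : ℝ, 0 < c ∧ ∀ (t : ℕ → ℝ) (w : ∀ j, Fin (D.N j) → ℝ) (j : ℕ),
        ∑ k, w j k = 1 → ∑ k, |w j k| ≤ A → (∀ k, k ∉ D.kept j (t j) → w j k = 0) →
        Integrable (D.estimator X U j (w j)) P ∧
        |∫ ω, D.estimator X U j (w j) ω ∂P -
            Needlet.bandSpectrum B a (Needlet.powerSpectrum X P) j| ≤
          c * B ^ (α * (j : ℝ)) * t j *
            Needlet.bandSpectrum B a (Needlet.powerSpectrum X P) j) ∧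
    -- without a mask, unbiasedness for arbitrary weights
    (∀ j : ℕ, (∀ k, D.W j k = 1) → ∀ w : Fin (D.N j) → ℝ, ∑ k, w k = 1 →
      Integrable (D.estimator X U j w) P ∧
      ∫ ω, D.estimator X U j w ω ∂P =
        Needlet.bandSpectrum B a (Needlet.powerSpectrum X P) j) :=
  proposition7_general P X hX.isStationaryField B hB M (by omega) a ha α hα hC c₀ κ hc₀ D U
    (hU.isWhiteNoise fun x => (hX.memLp x).aestronglyMeasurable)
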